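/- \textbf{Conventions.} A \emph{quasi-Dyck vector} (QDV) is a finite integer list $v=v_1\cdots v_n$ ($n\ge 1$) with $v_1=0$ and $v_{k+1}\le v_k+1$; it is a \emph{Dyck vector} if all $v_k\ge 0$. In words, $a^m$ means $m$ copies of the symbol $a$ (and $(A)^m$ means $m$ copies of the list $A$). An integer partition $\gamma$ with parts $\gamma_1\ge\gamma_2\ge\cdots$ (with $\gamma_k=0$ beyond the last part) and $\ell(\gamma)$ positive parts is identified with the class of all QDVs $\bigl(0-\gamma_n,1-\gamma_{n-1},\dots,(n-1)-\gamma_1\bigr)$, $n>\ell(\gamma)$; $[v]$ denotes the class (equivalently the partition) of a QDV $v$. $\mathrm{mind}(\gamma)$ is the least $n>\ell(\gamma)$ such that the diagram of $\gamma$ fits inside that of $(n-1,n-2,\dots,1,0)$; the representative of length $\mathrm{mind}(\gamma)$ is the \emph{reduced Dyck vector} of $\gamma$. $\mathrm{len}(v)$ and $\mathrm{area}(v)$ are the length and the sum of the entries of $v$. If $\gamma_1\le\ell(\gamma)+2$, put $\mathrm{NU}_1(\gamma)=(\ell+1,\gamma_1-1,\dots,\gamma_\ell-1)$ where $\ell=\ell(\gamma)$;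 otherwise $\mathrm{NU}_1(\gamma)$ is undefined. $\gamma$ is \emph{$\mathrm{NU}_1$-initial} if $\gamma_1<\ell(\gamma)$. $\mathrm{NU}_2$ is given by two rules. (i) $\mathrm{NU}_2([012^hA(-1)^{h-1}])=[00^{h-1}1A1^h]$ for $h\ge 2$ and every integer list $A$ that is empty, or has all entries $\le 2$, last entry $\ge 0$, and $A_{k+1}\le A_k+1$ for all $k$. (ii) $\mathrm{NU}_2([012^kB(-1)^k])=[00^kB01^k]$ for $k\ge 1$ and every integer list $B$ that is empty, or has all entries $\le 2$, first entry $\le 1$, last entry $\ge -1$, and $B_{j+1}\le B_j+1$ for all $j$. $\mathrm{NU}$ is $\mathrm{NU}_1$ where that is defined and $\mathrm{NU}_2$ elsewhere (where defined); the $\mathrm{NU}$-chain starting at $[v]$ is $[v],\mathrm{NU}([v]),\mathrm{NU}^2([v]),\dots$; a mind-profile is the sequence of $\mathrm{mind}$-values along (a part of) a chain. For a partition $\mu$ with $n_i$ parts equal to $i$ and largest part $r$, $\mathrm{TI}(\mu)=[0B_\mu]$ with $B_\mu=01^{n_1}01^{n_2}\cdots01^{n_r}$ (empty for the zero partition). \textbf{Theorem.}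 Let $v=0012^{n_0}12^{n_1}\cdots12^{n_r}C$ where $r\ge 0$, $n_i\ge 0$ for all $i$, $n_r>0$, and $C$ is a (possibly empty) list with entries in $\{0,1\}$; this is a Dyck vector. For $0\le i\le r+1$ let $p_i$ be the number of even integers among $n_0,\dots,n_{i-1}$. The $\mathrm{NU}$-chain starting at $[v]$ is infinite and contains only finitely many $\mathrm{NU}_1$-initial objects. Let $S_0(v)=v$ and let $S_1(v),\dots,S_J(v)$ be the reduced Dyck vectors of all $\mathrm{NU}_1$-initial objects among $\mathrm{NU}^i([v])$, $i>0$, in the order in which they appear. Put $L_j=\mathrm{len}(S_j(v))=\mathrm{mind}([S_j(v)])$. (a) The chain contains, in this order, $[v^{(0)}]=[v],[v^{(1)}],\dots,[v^{(r+1)}]$, where $$v^{(i)}=0012^{n_i}\cdots12^{n_r}1^{p_i}C\,1^{2\lfloor n_0/2\rfloor}01^{n_0\bmod 2}\cdots1^{2\lfloor n_{i-1}/2\rfloor}01^{n_{i-1}\bmod 2}\quad(0\le i\le r),$$ $$v^{(r+1)}=001^{p_{r+1}}C\,1^{2\lfloor n_0/2\rfloor}01^{n_0\bmod 2}\cdots1^{2\lfloor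 n_{r-1}/2\rfloor}01^{n_{r-1}\bmod 2}\,1^{2\lfloor n_r/2\rfloor}(01)^{n_r\bmod 2},$$ and $[v^{(r+1)}]=\mathrm{TI}(\mu)$ for some partition $\mu$. (b) Let $L=\mathrm{len}(v^{(i)})$; then $L=\mathrm{mind}([v^{(i)}])$. For $i\le r$ the mind-profile from $[v^{(i)}]$ through $[v^{(i+1)}]$ is $L,(L+1,L)^{\lceil n_i/2\rceil}$, followed by $(L+1)^L$ if $n_i$ is even and $i<r$. For $i=r+1$ the mind-profile from $[v^{(r+1)}]$ onward is $L\,(L+1)^L(L+2)^{L+1}(L+3)^{L+2}\cdots$. (c) For all $i>0$, $\mathrm{NU}^i([v])$ is $\mathrm{NU}_1$-initial if and only if $\mathrm{mind}(\mathrm{NU}^{i-1}([v]))>\mathrm{mind}(\mathrm{NU}^i([v]))$. (d) The reduced vectors $S_j(v)$ of the $\mathrm{NU}_1$-initial objects in the chain starting at $[v]$ are exactly: $v$ itself, if $C$ is empty or ends in $1$; $v^{(i)}$ for each $0<i\le r+1$ with $n_{i-1}$ odd; and all vectors $$0012^{n_i-2c}12^{n_{i+1}}\cdots12^{n_r}1^{p_i}C\,1^{2\lfloor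 n_0/2\rfloor}01^{n_0\bmod 2}\cdots1^{2\lfloor n_{i-1}/2\rfloor}01^{n_{i-1}\bmod 2}1^{2c}$$ with $0\le i\le r$ and $0<2c\le n_i$. Moreover $S_J(v)=v^{(r+1)}$. (e) Each $S_j(v)$ except $S_J(v)$ contains a $2$, and $S_J(v)$ does not. For $j>0$, $S_j(v)$ is a reduced Dyck vector of the form $00X1$ with all entries of $X$ in $\{0,1,2\}$; no other reduced representatives of classes in the chain from $\mathrm{NU}([v])$ to $[S_J(v)]$ have this form. For every $\delta$ in the chain, $\mathrm{mind}(\delta)<\mathrm{mind}(\mathrm{NU}(\delta))$ if and only if the reduced Dyck vector of $\delta$ begins with $00$. (f) For $0\le j<J$, the mind-profile from $[S_j(v)]$ to just before $[S_{j+1}(v)]$ is a prefix of $L_j(L_j+1)^{L_j}(L_j+2)^{L_j+1}\cdots$. Each $[S_j(v)]$ is immediately followed, and if $j>0$ immediately preceded, in the chain by an object with $\mathrm{mind}$ equal to $L_j+1$. Hence $L_0\le L_1\le\cdots\le L_J$. (g) For $0\le j<J$, $\mathrm{area}(S_{j+1}(v))=\mathrm{area}(S_j(v))-2$. -/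

import Mathlib

namespace DyckChain

/-! Integer partitions are Young diagrams `γ`: the `k`-th part is `γ.rowLen (k - 1)` (zero beyond
the last part), and the number of positive parts is `γ.colLen 0`. -/

/-- Quasi-Dyck vectors. -/
def IsQDV (v : List ℤ) : Prop :=
  v.head? = some 0 ∧ v.IsChain (fun a b => b ≤ a + 1)

/-- Dyck vectors. -/
def IsDyck (v : List ℤ) : Prop :=
  IsQDV v ∧ ∀ x ∈ v, 0 ≤ x

/-- The list `(0 - γ_n, 1 - γ_{n-1}, …, (n-1) - γ_1)`. -/
def qdv (n : ℕ) (γ : YoungDiagram) : List ℤ :=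
  (List.range n).map fun i : ℕ => (i : ℤ) - γ.rowLen (n - 1 - i)

/-- The list `(n-1-v_n, n-2-v_{n-1}, …, 0-v_1)`, where `n` is the length of `v`. -/
def partsOf (v : List ℤ) : List ℕ :=
  List.ofFn fun k : Fin v.length =>
    (((v.length - 1 - k : ℕ) : ℤ) - v.getD (v.length - 1 - k) 0).toNat

theorem IsQDV.length_pos {v : List ℤ} (h : IsQDV v) : 0 < v.length := by
  rcases v with _ | ⟨a, v⟩
  · simp [IsQDV] at h
  · simp

theorem IsQDV.step {v : List ℤ} (h : IsQDV v) {i : ℕ} (hi : i + 1 < v.length) :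
    v.getD (i + 1) 0 ≤ v.getD i 0 + 1 := by
  have := List.isChain_iff_getElem.1 h.2 i hi
  rw [List.getD_eq_getElem _ _ hi, List.getD_eq_getElem _ _ (by omega)]
  exact this

theorem IsQDV.mono {v : List ℤ} (h : IsQDV v) {i : ℕ} (d : ℕ) (hi : i + d < v.length) :
    (i : ℤ) - v.getD i 0 ≤ ((i + d : ℕ) : ℤ) - v.getD (i + d) 0 := by
  induction d with
  | zero => simp
  | succ d ih =>
    have h1 := ih (by omega)
    have h2 := h.step (i := i + d) (by omega)
    rw [← Nat.add_assoc]
    push_cast at h1 ⊢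
    linarith

theorem IsQDV.getD_zero {v : List ℤ} (h : IsQDV v) : v.getD 0 0 = 0 := by
  rcases v with _ | ⟨a, v⟩
  · simp
  · simpa [IsQDV] using h.1

theorem IsQDV.nonneg {v : List ℤ} (h : IsQDV v) {i : ℕ} (hi : i < v.length) :
    0 ≤ (i : ℤ) - v.getD i 0 := by
  have := h.mono (i := 0) i (by omega)
  rw [h.getD_zero] at this
  simpa using this

theorem partsOf_sorted {v : List ℤ} (h : IsQDV v) : (partsOf v).SortedGE := by
  apply Antitone.sortedGE_ofFn
  intro a b hab
  have hb := b.2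
  have hab' : (a : ℕ) ≤ b := hab
  have := h.mono (i := v.length - 1 - b) ((b : ℕ) - a) (by omega)
  rw [show v.length - 1 - (b : ℕ) + ((b : ℕ) - a) = v.length - 1 - a by omega] at this
  exact Int.toNat_le_toNat this

open Classical in
/-- The Dyck class `[v]` of a quasi-Dyck vector `v`, identified with the partition it stands for
(the one whose parts are listed by `partsOf v`). Only used for quasi-Dyck vectors. -/
noncomputable def cls (v : List ℤ) : YoungDiagram :=
  if h : IsQDV v then YoungDiagram.ofRowLens (partsOf v) (partsOf_sorted h) else ⊥

theorem rowLen_ofRowLens_getD (w : List ℕ) (hw : w.SortedGE) (k : ℕ) :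
    (YoungDiagram.ofRowLens w hw).rowLen k = w.getD k 0 := by
  refine eq_of_forall_lt_iff fun j => ?_
  rw [← YoungDiagram.mem_iff_lt_rowLen, YoungDiagram.mem_ofRowLens]
  by_cases hk : k < w.length
  · simp [hk]
  · simp [hk]

theorem rowLen_cls {v : List ℤ} (h : IsQDV v) {k : ℕ} (hk : k < v.length) :
    ((cls v).rowLen k : ℤ) = ((v.length - 1 - k : ℕ) : ℤ) - v.getD (v.length - 1 - k) 0 := by
  have h0 := h.nonneg (i := v.length - 1 - k) (by omega)
  rw [cls, dif_pos h, rowLen_ofRowLens_getD, List.getD_eq_getElem _ _ (by simpa [partsOf] using hk)]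
  simp only [partsOf, List.getElem_ofFn]
  exact Int.toNat_of_nonneg h0

/-- `cls` inverts `qdv`: a quasi-Dyck vector is recovered from its length and its class. -/
theorem qdv_cls {v : List ℤ} (h : IsQDV v) : qdv v.length (cls v) = v := by
  apply List.ext_getElem
  · simp [qdv]
  · intro i h1 h2
    simp only [qdv, List.getElem_map, List.getElem_range]
    rw [rowLen_cls h (by omega), show v.length - 1 - (v.length - 1 - i) = i by omega,
      List.getD_eq_getElem _ _ h2]
    ring

/-- `v` and `0 v⁺` have the same class. -/
theorem cls_shift {v : List ℤ} (h : IsQDV v) : cls (0 :: v.map (· + 1)) = cls v := by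
  have hlen := h.length_pos
  have hQ : IsQDV (0 :: v.map (· + 1)) := by
    refine ⟨rfl, ?_⟩
    rw [List.isChain_iff_getElem]
    intro i hi
    rcases i with _ | i
    · have := h.getD_zero
      rw [List.getD_eq_getElem _ _ hlen] at this
      simp [this]
    · have := List.isChain_iff_getElem.1 h.2 i (by simpa using hi)
      simpa using this
  have key : ∀ k, (cls (0 :: v.map (· + 1))).rowLen k = (cls v).rowLen k := by
    intro k
    by_cases hk : k < v.length
    · have h1 := rowLen_cls hQ (k := k) (by simp; omega)
      have h2 := rowLen_cls h hk
      simp only [List.length_cons, List.length_map] at h1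
      rw [show v.length + 1 - 1 - k = (v.length - 1 - k) + 1 by omega, List.getD_cons_succ,
        List.getD_eq_getElem _ _ (by simp; omega), List.getElem_map] at h1
      rw [List.getD_eq_getElem _ _ (by omega)] at h2
      push_cast at h1
      omega
    · rw [cls, dif_pos hQ, cls, dif_pos h, rowLen_ofRowLens_getD, rowLen_ofRowLens_getD,
        List.getD_eq_default (partsOf v) 0 (by simp [partsOf]; omega)]
      by_cases hk' : k = v.length
      · subst hk'
        rw [List.getD_eq_getElem _ _ (by simp [partsOf])]
        simp only [partsOf, List.getElem_ofFn, List.length_cons, List.length_map,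
          Nat.add_sub_cancel]
        simp
      · rw [List.getD_eq_default _ _ (by simp [partsOf]; omega)]
  ext ⟨i, j⟩
  rw [YoungDiagram.mem_cells, YoungDiagram.mem_cells, YoungDiagram.mem_iff_lt_rowLen, YoungDiagram.mem_iff_lt_rowLen, key]

/-- The staircase `Δ_n = ⟨n-1, …, 2, 1, 0⟩`. -/
def staircase (n : ℕ) : YoungDiagram :=
  YoungDiagram.ofRowLens (List.ofFn fun k : Fin n => n - 1 - (k : ℕ))
    (Antitone.sortedGE_ofFn fun a b hab => by
      have : (a : ℕ) ≤ b := hab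
      show n - 1 - (b : ℕ) ≤ n - 1 - (a : ℕ)
      omega)

/-- Minimum triangle height. -/
noncomputable def mind (γ : YoungDiagram) : ℕ :=
  sInf {n | γ.colLen 0 < n ∧ γ ≤ staircase n}

/-- The reduced Dyck vector of a Dyck class. -/
noncomputable def reduced (γ : YoungDiagram) : List ℤ :=
  qdv (mind γ) γ

/-- `v` is the reduced Dyck vector of its class. -/
def IsReducedVec (v : List ℤ) : Prop :=
  IsDyck v ∧ reduced (cls v) = v

theorem nuOne_sorted {γ : YoungDiagram} (h : γ.rowLen 0 ≤ γ.colLen 0 + 2) :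
    ((γ.colLen 0 + 1) :: γ.rowLens.map (· - 1)).SortedGE := by
  rw [List.sortedGE_iff_pairwise, List.pairwise_cons]
  constructor
  · intro x hx
    simp only [YoungDiagram.rowLens, List.mem_map, List.mem_range] at hx
    obtain ⟨a, ⟨i, -, rfl⟩, rfl⟩ := hx
    have := γ.rowLen_anti 0 i (Nat.zero_le i)
    omega
  · rw [List.pairwise_map]
    exact (YoungDiagram.rowLens_sorted γ).pairwise.imp fun hab => Nat.sub_le_sub_right hab 1

/-- The map `NU₁`, sending `γ` with `γ_1 ≤ ℓ(γ) + 2` to `⟨ℓ+1, γ_1-1, …, γ_ℓ-1⟩`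
and undefined (`none`) on other partitions. -/
def nuOne (γ : YoungDiagram) : Option YoungDiagram :=
  if h : γ.rowLen 0 ≤ γ.colLen 0 + 2 then
    some (YoungDiagram.ofRowLens _ (nuOne_sorted h))
  else none

/-- `NU₁`-initial objects: those outside the domain `{γ : γ_1 ≥ ℓ(γ)}` of the inverse of `NU₁`. -/
def IsInitial (γ : YoungDiagram) : Prop :=
  γ.rowLen 0 < γ.colLen 0

/-- Rule (a): `0 1 2^h A (-1)^(h-1)` goes to `0 0^(h-1) 1 A 1^h`. -/
def RuleA (v w : List ℤ) : Prop :=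
  ∃ (h : ℕ) (A : List ℤ), 2 ≤ h ∧
    (∀ x ∈ A, x ≤ 2) ∧ (∀ x ∈ A.getLast?, 0 ≤ x) ∧ A.IsChain (fun a b => b ≤ a + 1) ∧
    v = [0, 1] ++ List.replicate h 2 ++ A ++ List.replicate (h - 1) (-1) ∧
    w = [0] ++ List.replicate (h - 1) 0 ++ [1] ++ A ++ List.replicate h 1

/-- Rule (b): `0 1 2^k B (-1)^k` goes to `0 0^k B 0 1^k`. -/
def RuleB (v w : List ℤ) : Prop :=
  ∃ (k : ℕ) (B : List ℤ), 1 ≤ k ∧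
    (∀ x ∈ B, x ≤ 2) ∧ (∀ x ∈ B.head?, x ≤ 1) ∧ (∀ x ∈ B.getLast?, -1 ≤ x) ∧
    B.IsChain (fun a b => b ≤ a + 1) ∧
    v = [0, 1] ++ List.replicate k 2 ++ B ++ List.replicate k (-1) ∧
    w = [0] ++ List.replicate k 0 ++ B ++ [0] ++ List.replicate k 1

/-- The graph of the map `NU₂` on Dyck classes. -/
def NuTwoRel (γ δ : YoungDiagram) : Prop :=
  ∃ v w : List ℤ, (RuleA v w ∨ RuleB v w) ∧ IsQDV v ∧ IsQDV w ∧ cls v = γ ∧ cls w = δ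

theorem getLast_qdv {n : ℕ} {γ : YoungDiagram} (hn : 0 < n) :
    (qdv n γ).getLast? = some (((n : ℤ) - 1) - γ.rowLen 0) := by
  obtain ⟨m, rfl⟩ : ∃ m, n = m + 1 := ⟨n - 1, by omega⟩
  simp [qdv, List.range_succ]

/-- A class has at most one representative ending in a given symbol. -/
theorem eq_of_cls_eq {v w : List ℤ} (hv : IsQDV v) (hw : IsQDV w) (h : cls v = cls w)
    (hl : v.getLast? = w.getLast?) : v = w := by
  rw [← qdv_cls hv, ← qdv_cls hw, h] at hl
  rw [getLast_qdv hv.length_pos, getLast_qdv hw.length_pos] at hl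
  have hlen : v.length = w.length := by
    have := Option.some.inj hl
    omega
  rw [← qdv_cls hv, ← qdv_cls hw, h, hlen]

theorem replicate_append_le {c : ℤ} {m n : ℕ} {R T : List ℤ} (hT : T.head? ≠ some c)
    (h : List.replicate m c ++ R = List.replicate n c ++ T) : m ≤ n := by
  induction m generalizing n with
  | zero => omega
  | succ m ih =>
    cases n with
    | zero =>
      simp only [List.replicate_succ, List.cons_append, List.replicate_zero, List.nil_append] at h
      rw [← h] at hT
      simp at hT
    | succ n =>
      simp only [List.replicate_succ, List.cons_append, List.cons.injEq, true_and] at h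
      have := ih h
      omega

theorem head_tailA {h : ℕ} {A : List ℤ} (hh : 2 ≤ h) (hA : ∀ x ∈ A.getLast?, 0 ≤ x) :
    (A.reverse ++ (List.replicate h 2 ++ [1, 0])).head? ≠ some (-1) := by
  obtain ⟨m, rfl⟩ : ∃ m, h = m + 1 := ⟨h - 1, by omega⟩
  rcases hx : A.getLast? with _ | x
  · rw [List.getLast?_eq_none_iff] at hx
    simp [hx, List.replicate_succ]
  · have := hA x hx
    simp only [List.head?_append, List.head?_reverse, hx, Option.some_or]
    intro hc
    have := Option.some.inj hc
    omega

theorem head_tailB {k : ℕ} {B : List ℤ} (hk : 1 ≤ k) (hB : ∀ x ∈ B.head?, x ≤ 1) :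
    (B ++ List.replicate k (-1 : ℤ)).head? ≠ some 2 := by
  obtain ⟨m, rfl⟩ : ∃ m, k = m + 1 := ⟨k - 1, by omega⟩
  rcases hx : B.head? with _ | x
  · rw [List.head?_eq_none_iff] at hx
    simp [hx, List.replicate_succ]
  · have := hB x hx
    simp only [List.head?_append, hx, Option.some_or]
    intro hc
    have := Option.some.inj hc
    omega

theorem rule_AA {v w z : List ℤ} (h1 : RuleA v w) (h2 : RuleA v z) : w = z := by
  obtain ⟨h, A, hh, -, hA, -, hv, rfl⟩ := h1
  obtain ⟨k, B, hk, -, hB, -, hv', rfl⟩ := h2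
  have e := congrArg List.reverse (hv.symm.trans hv')
  simp only [List.reverse_append, List.reverse_replicate, List.reverse_cons, List.append_assoc,
    List.nil_append, List.cons_append] at e
  have l1 := replicate_append_le (head_tailA hk hB) e
  have l2 := replicate_append_le (head_tailA hh hA) e.symm
  obtain rfl : h = k := by omega
  have := hv.symm.trans hv'
  simp only [List.append_assoc, List.append_cancel_left_eq, List.append_cancel_right_eq] at this
  rw [this]

theorem rule_BB {v w z : List ℤ} (h1 : RuleB v w) (h2 : RuleB v z) : w = z := by
  obtain ⟨h, A, hh, -, hA, -, -, hv, rfl⟩ := h1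
  obtain ⟨k, B, hk, -, hB, -, -, hv', rfl⟩ := h2
  have e := hv.symm.trans hv'
  simp only [List.append_assoc, List.append_cancel_left_eq] at e
  have l1 := replicate_append_le (head_tailB hk hB) e
  have l2 := replicate_append_le (head_tailB hh hA) e.symm
  obtain rfl : h = k := by omega
  simp only [List.append_cancel_left_eq, List.append_cancel_right_eq] at e
  rw [e]

theorem rule_AB {v w z : List ℤ} (h1 : RuleA v w) (h2 : RuleB v z) : False := by
  obtain ⟨h, A, hh, -, hA, -, hv, rfl⟩ := h1
  obtain ⟨k, B, hk, -, hB, -, -, hv', rfl⟩ := h2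
  have e := hv.symm.trans hv'
  simp only [List.append_assoc, List.append_cancel_left_eq] at e
  have l1 := replicate_append_le (head_tailB hk hB) e
  have e2 := congrArg List.reverse (hv'.symm.trans hv)
  simp only [List.reverse_append, List.reverse_replicate, List.reverse_cons, List.append_assoc,
    List.nil_append, List.cons_append] at e2
  have l2 := replicate_append_le (head_tailA hh hA) e2
  omega

theorem rule_last {v w : List ℤ} (h : RuleA v w ∨ RuleB v w) : v.getLast? = some (-1) := by
  rcases h with ⟨h, A, hh, -, -, -, rfl, -⟩ | ⟨k, B, hk, -, -, -, -, rfl, -⟩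
  · rw [List.getLast?_append, List.getLast?_replicate, if_neg (by omega)]
    rfl
  · rw [List.getLast?_append, List.getLast?_replicate, if_neg (by omega)]
    rfl

/-- The two rules give a well-defined (single-valued) map on Dyck classes. -/
theorem NuTwoRel.unique {γ δ ε : YoungDiagram} (h1 : NuTwoRel γ δ) (h2 : NuTwoRel γ ε) :
    δ = ε := by
  obtain ⟨v, w, hr, hv, -, rfl, rfl⟩ := h1
  obtain ⟨v', w', hr', hv', -, he, rfl⟩ := h2
  obtain rfl := eq_of_cls_eq hv' hv he ((rule_last hr').trans (rule_last hr).symm)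
  rcases hr with ha | hb <;> rcases hr' with ha' | hb'
  · rw [rule_AA ha ha']
  · exact (rule_AB ha hb').elim
  · exact (rule_AB ha' hb).elim
  · rw [rule_BB hb hb']

open Classical in
/-- The map `NU₂`, undefined (`none`) outside its domain. -/
noncomputable def nuTwo (γ : YoungDiagram) : Option YoungDiagram :=
  if h : ∃ δ, NuTwoRel γ δ then some h.choose else none

theorem nuTwo_eq_some_iff {γ δ : YoungDiagram} : nuTwo γ = some δ ↔ NuTwoRel γ δ := by
  unfold nuTwo
  split_ifs with h
  · rw [Option.some.injEq]
    exact ⟨fun e => e ▸ h.choose_spec, fun e => h.choose_spec.unique e⟩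
  · exact ⟨fun e => by simp at e, fun e => (h ⟨δ, e⟩).elim⟩

/-- The extended map `NU`: it is `NU₁` on the domain of `NU₁`, and `NU₂` elsewhere. -/
noncomputable def nu (γ : YoungDiagram) : Option YoungDiagram :=
  (nuOne γ).or (nuTwo γ)

/-- The iterate `NU^t(γ)`, `none` once `NU` is undefined. -/
noncomputable def nuIter (γ : YoungDiagram) (t : ℕ) : Option YoungDiagram :=
  (fun o => o.bind nu)^[t] (some γ)

/-- The word `B_μ = 0 1^{n_1} 0 1^{n_2} ⋯ 0 1^{n_r}`, where `r = μ_1` and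
`n_i` is the number of parts of `μ` equal to `i`. -/
def bWord (μ : YoungDiagram) : List ℤ :=
  (List.range (μ.rowLen 0)).flatMap fun i => 0 :: List.replicate (μ.rowLens.count (i + 1)) 1

/-- The tail-initiator of `μ`. -/
noncomputable def tailInit (μ : YoungDiagram) : YoungDiagram :=
  cls (0 :: bWord μ)

/-- Position `0`, and the positions `t > 0` at which the `NU`-chain from `[v]` is at a
`NU₁`-initial object. -/
def IsMark (v : List ℤ) (t : ℕ) : Prop :=
  t = 0 ∨ ∃ γ, nuIter (cls v) t = some γ ∧ IsInitial γ

/-- The position in the `NU`-chain from `[v]` of the object `[S_j(v)]`. -/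
noncomputable def posS (v : List ℤ) (j : ℕ) : ℕ :=
  Nat.nth (IsMark v) j

/-- The number `J` of positions `t > 0` at which the chain from `[v]` is at a `NU₁`-initial object
(meaningful when there are finitely many). -/
noncomputable def numS (v : List ℤ) : ℕ :=
  {t | 0 < t ∧ IsMark v t}.ncard

/-- `S_0(v) = v`, and `S_j(v)` for `j > 0` is the reduced Dyck vector of the `j`-th `NU₁`-initial
object among `NU([v]), NU²([v]), …`. -/
noncomputable def vecS (v : List ℤ) (j : ℕ) : List ℤ :=
  if j = 0 then v else ((nuIter (cls v) (posS v j)).map reduced).getD []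

/-- The initial part `L (L+1)^L (L+2)^(L+1) ⋯ (L+k)^(L+k-1)` of the infinite sequence
`L (L+1)^L (L+2)^(L+1) ⋯`. -/
def plateaus (L k : ℕ) : List ℕ :=
  L :: (List.range k).flatMap fun c => List.replicate (L + c) (L + c + 1)

/-- The word `1 2^{n_i} 1 2^{n_{i+1}} ⋯ 1 2^{n_r}` (empty if `i > r`). -/
def twos (n : ℕ → ℕ) (i r : ℕ) : List ℤ :=
  (List.range' i (r + 1 - i)).flatMap fun k => 1 :: List.replicate (n k) 2

/-- `p_i`, the number of even integers in the list `n_0, …, n_{i-1}`. -/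
def numEven (n : ℕ → ℕ) (i : ℕ) : ℕ :=
  (List.range i).countP fun k => n k % 2 = 0

/-- The concatenation over `k = 0, …, i-1` of the words
`1^{2⌊n_k/2⌋} 0 1^{n_k mod 2}`. -/
def trail (n : ℕ → ℕ) (i : ℕ) : List ℤ :=
  (List.range i).flatMap fun k =>
    List.replicate (2 * (n k / 2)) 1 ++ [0] ++ List.replicate (n k % 2) 1

/-- The vectors `v^{(i)}` for `0 ≤ i ≤ r` (first case) and `i = r+1` (second case). -/
def vecV (n : ℕ → ℕ) (r : ℕ) (C : List ℤ) (i : ℕ) : List ℤ :=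
  if i ≤ r then
    [0, 0] ++ twos n i r ++ List.replicate (numEven n i) 1 ++ C ++ trail n i
  else
    [0, 0] ++ List.replicate (numEven n (r + 1)) 1 ++ C ++ trail n r ++
      List.replicate (2 * (n r / 2)) 1 ++ (List.replicate (n r % 2) [0, 1]).flatten

/-- The vectors
`0 0 1 2^{n_i-2c} 1 2^{n_{i+1}} ⋯ 1 2^{n_r} 1^{p_i} C (trail of n_0, …, n_{i-1}) 1^{2c}`. -/
def vecW (n : ℕ → ℕ) (r : ℕ) (C : List ℤ) (i c : ℕ) : List ℤ :=
  [0, 0, 1] ++ List.replicate (n i - 2 * c) 2 ++ twos n (i + 1) r ++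
    List.replicate (numEven n i) 1 ++ C ++ trail n i ++ List.replicate (2 * c) 1

/-- Words of the form `0 0 X 1` with all symbols of `X` in `{0, 1, 2}`. -/
def IsForm (u : List ℤ) : Prop :=
  ∃ X : List ℤ, (∀ x ∈ X, x = 0 ∨ x = 1 ∨ x = 2) ∧ u = [0, 0] ++ X ++ [1]

end DyckChain

open DyckChain

namespace DyckChain

/-! The chain is followed through the vectors `0 0 W D`, where `W = 1 2^{a_1} 1 2^{a_2} ⋯` and `D`
is binary. Such a vector is encoded by the state `(l, D)` with `l` the list of exponents, and `next`
says which vector of this shape comes next.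

On a Dyck vector `0 1 ⋯ m Z` with `Z` nonempty, first entry of `Z` at most `m` and last entry at
least `m - 2`, `NU₁` deletes the `m` and appends `m - 1` (`nuOne_ramp`). From `0 0 X` of length `L`,
one step on the shifted representative gives `0 1 X⁺ 0` of length `L + 1`. There are then two cases.
If `X` starts with `12` (`Drops`), the vector begins with `0123` and ends in `0`, so `NU₁` is
undefined. Rule (ii) with `k = 1` (first exponent 1) or rule (i) with `h = 2` (first exponent at
least 2) leads at once to the next state: the length is again `L`, the area falls by 2, and the
object is `NU₁`-initial (`nu_of_drops`). Otherwise `NU₁` carries the entries of `X⁺`, lowered by 1,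
to the end one at a time, until `00` reappears after `L` steps in all. The length is then `L + 1`,
the area is unchanged, and no initial object is met (`flatRun_of_not_drops`).

Thus the chain is a concatenation of blocks (`block`): a block starts at a vector of length `L`, and
all its other objects have `mind` equal to `L + 1` and reduced vectors that start with `01`. The
mind-profile, the initial objects, the areas and the shapes are all read off from the indices at
which the orbit of `next` drops. There are finitely many of these, since the exponents are used up.
The explicit vectors come from iterating `next`: a group `2^{n_i}` loses its 2's in pairs, and its
parity decides how the group is finally removed. -/

/-! ### Row lengths and `mind` of the class of a Dyck vector. -/

theorem eq_of_rowLen_eq {γ δ : YoungDiagram} (h : ∀ k, γ.rowLen k = δ.rowLen k) : γ = δ := by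
  ext ⟨i, j⟩
  rw [YoungDiagram.mem_cells, YoungDiagram.mem_cells, YoungDiagram.mem_iff_lt_rowLen,
    YoungDiagram.mem_iff_lt_rowLen, h]

theorem lt_colLen_zero {γ : YoungDiagram} {k : ℕ} : k < γ.colLen 0 ↔ 0 < γ.rowLen k := by
  rw [← YoungDiagram.mem_iff_lt_colLen, YoungDiagram.mem_iff_lt_rowLen]

theorem le_of_rowLen_le {γ δ : YoungDiagram} (h : ∀ k, γ.rowLen k ≤ δ.rowLen k) : γ ≤ δ := by
  rintro ⟨i, j⟩ hc
  have hc' : (i, j) ∈ γ := hc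
  show (i, j) ∈ δ
  rw [YoungDiagram.mem_iff_lt_rowLen] at hc' ⊢
  exact hc'.trans_le (h i)

theorem rowLen_le_of_le {γ δ : YoungDiagram} (h : γ ≤ δ) (k : ℕ) : γ.rowLen k ≤ δ.rowLen k := by
  by_contra! hc
  have h1 : (k, δ.rowLen k) ∈ γ := YoungDiagram.mem_iff_lt_rowLen.2 hc
  have h2 : (k, δ.rowLen k) ∈ δ := h h1
  exact lt_irrefl _ (YoungDiagram.mem_iff_lt_rowLen.1 h2)

theorem rowLen_staircase (n k : ℕ) : (staircase n).rowLen k = n - 1 - k := by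
  rw [staircase, rowLen_ofRowLens_getD]
  by_cases hk : k < n
  · rw [List.getD_eq_getElem _ _ (by simpa using hk)]
    simp
  · rw [List.getD_eq_default _ _ (by simpa using hk)]
    omega

theorem rowLen_cls_of_length_le {v : List ℤ} (h : IsQDV v) {k : ℕ} (hk : v.length ≤ k) :
    (cls v).rowLen k = 0 := by
  rw [cls, dif_pos h, rowLen_ofRowLens_getD, List.getD_eq_default _ _ (by simpa [partsOf] using hk)]

theorem colLen_cls_lt {v : List ℤ} (h : IsQDV v) : (cls v).colLen 0 < v.length := by
  have hl := h.length_pos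
  by_contra! hc
  have h1 : v.length - 1 < (cls v).colLen 0 := by omega
  rw [lt_colLen_zero] at h1
  have h2 := rowLen_cls h (k := v.length - 1) (by omega)
  rw [Nat.sub_self, h.getD_zero] at h2
  push_cast at h2
  omega

/-- An entry 0 after the first one is a nonempty row that fills its whole row of the staircase, so
no smaller staircase contains the diagram. -/
theorem mind_cls {v : List ℤ} (h : IsDyck v) (h0 : 0 ∈ v.tail) : mind (cls v) = v.length := by
  have hl := h.1.length_pos
  have hmem : v.length ∈ {n | (cls v).colLen 0 < n ∧ cls v ≤ staircase n} := by
    refine ⟨colLen_cls_lt h.1, le_of_rowLen_le fun k => ?_⟩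
    rw [rowLen_staircase]
    rcases lt_or_ge k v.length with hk | hk
    · have h1 := rowLen_cls h.1 hk
      have h2 : 0 ≤ v.getD (v.length - 1 - k) 0 := by
        rw [List.getD_eq_getElem _ _ (by omega)]
        exact h.2 _ (List.getElem_mem _)
      omega
    · rw [rowLen_cls_of_length_le h.1 hk]
      omega
  refine le_antisymm (Nat.sInf_le hmem) (le_csInf ⟨_, hmem⟩ ?_)
  rintro n ⟨-, hn⟩
  obtain ⟨p, hp, hp0⟩ := List.getElem_of_mem h0
  rw [List.length_tail] at hp
  rw [List.getElem_tail] at hp0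
  have h1 := rowLen_le_of_le hn (v.length - 1 - (p + 1))
  have h2 := rowLen_cls h.1 (k := v.length - 1 - (p + 1)) (by omega)
  rw [show v.length - 1 - (v.length - 1 - (p + 1)) = p + 1 by omega,
    List.getD_eq_getElem _ _ (by omega), hp0] at h2
  rw [rowLen_staircase] at h1
  omega

theorem reduced_cls {v : List ℤ} (h : IsDyck v) (h0 : 0 ∈ v.tail) : reduced (cls v) = v := by
  rw [reduced, mind_cls h h0, qdv_cls h.1]

/-! ### `NU₁` and initial objects in terms of the initial ramp of a vector. -/

/-- The list `0, 1, …, m - 1`. -/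
def ramp (m : ℕ) : List ℤ :=
  (List.range m).map fun i : ℕ => (i : ℤ)

theorem ramp_succ (m : ℕ) : ramp (m + 1) = ramp m ++ [(m : ℤ)] := by
  simp [ramp, List.range_succ]

theorem length_ramp (m : ℕ) : (ramp m).length = m := by
  simp [ramp]

theorem getD_ramp_append {m i : ℕ} (h : i < m) (Z : List ℤ) : (ramp m ++ Z).getD i 0 = i := by
  rw [List.getD_append _ _ _ _ (by rwa [length_ramp]),
    List.getD_eq_getElem _ _ (by rwa [length_ramp])]
  simp [ramp]

theorem getD_ramp_append_right {m i : ℕ} (h : m ≤ i) (Z : List ℤ) :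
    (ramp m ++ Z).getD i 0 = Z.getD (i - m) 0 := by
  rw [List.getD_append_right _ _ _ _ (by rwa [length_ramp]), length_ramp]

theorem rowLen_zero_cls {v : List ℤ} {x : ℤ} (h : IsQDV (v ++ [x])) :
    ((cls (v ++ [x])).rowLen 0 : ℤ) = v.length - x := by
  rw [rowLen_cls h (by simp)]
  simp

theorem colLen_cls_le {m : ℕ} {Z : List ℤ} (h : IsQDV (ramp m ++ Z)) :
    (cls (ramp m ++ Z)).colLen 0 ≤ Z.length := by
  by_contra! hc
  rw [lt_colLen_zero] at hc
  rcases lt_or_ge Z.length (ramp m ++ Z).length with hk | hk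
  · have h1 := rowLen_cls h hk
    rw [List.length_append, length_ramp] at h1 hk
    rw [getD_ramp_append (by omega)] at h1
    omega
  · rw [rowLen_cls_of_length_le h hk] at hc
    omega

/-- The entries of the ramp are the zero parts, and a first entry of `Z` below `m` gives a positive
part. Together with `rowLen_zero_cls`, which reads the largest part off the last entry, this turns
conditions on `γ_1` and `ℓ(γ)` into a comparison of the last entry with `m`. -/
theorem colLen_cls {m : ℕ} {Z : List ℤ} (h : IsQDV (ramp m ++ Z)) (hZ : Z ≠ [])
    (hh : ∀ x ∈ Z.head?, x < m) : (cls (ramp m ++ Z)).colLen 0 = Z.length := by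
  refine le_antisymm (colLen_cls_le h) ?_
  obtain ⟨x, Y, rfl⟩ := List.exists_cons_of_ne_nil hZ
  have hx : x < m := hh x rfl
  rw [List.length_cons]
  refine Nat.succ_le_of_lt (lt_colLen_zero.2 ?_)
  have h1 := rowLen_cls h (k := Y.length) (by simp; omega)
  rw [List.length_append, length_ramp, List.length_cons,
    show m + (Y.length + 1) - 1 - Y.length = m by omega, getD_ramp_append_right le_rfl] at h1
  simp at h1
  omega

theorem isInitial_cls {Y : List ℤ} {x : ℤ} (h : IsQDV (0 :: 0 :: (Y ++ [x]))) (hx : 1 ≤ x) :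
    IsInitial (cls (0 :: 0 :: (Y ++ [x]))) := by
  have e : (0 :: 0 :: (Y ++ [x]) : List ℤ) = ramp 1 ++ (0 :: (Y ++ [x])) := by simp [ramp]
  have h1 := colLen_cls (e ▸ h) (by simp) (by simp)
  have h2 := rowLen_zero_cls (v := 0 :: 0 :: Y) (x := x) h
  rw [← e] at h1
  simp only [List.cons_append] at h2
  rw [IsInitial, h1]
  simp at h2 ⊢
  omega

theorem not_isInitial_cls {m : ℕ} {Z : List ℤ} {x : ℤ} (h : IsQDV (ramp m ++ (Z ++ [x])))
    (hx : x < m) : ¬ IsInitial (cls (ramp m ++ (Z ++ [x]))) := by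
  have h1 := colLen_cls_le h
  have h2 := rowLen_zero_cls (v := ramp m ++ Z) (x := x) (by simpa using h)
  rw [List.append_assoc] at h2
  rw [IsInitial, not_lt]
  simp [length_ramp] at h1 h2
  omega

theorem isQDV_append {m : ℕ} (hm : 1 ≤ m) {Z : List ℤ} :
    IsQDV (ramp m ++ Z) ↔ Z.IsChain (fun a b => b ≤ a + 1) ∧ ∀ x ∈ Z.head?, x ≤ m := by
  have hc : ∀ m, (ramp m).IsChain (fun a b => b ≤ a + 1) := by
    intro m
    rw [List.isChain_iff_getElem]
    intro i hi
    simp [ramp]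
  obtain ⟨m, rfl⟩ : ∃ k, m = k + 1 := ⟨m - 1, by omega⟩
  have hhead : (ramp (m + 1) ++ Z).head? = some 0 := by
    simp [ramp, List.range_succ_eq_map]
  have hlast : (ramp (m + 1)).getLast? = some (m : ℤ) := by
    simp [ramp_succ]
  rw [IsQDV, List.isChain_append, hhead, hlast]
  simp [hc]

/-- Removing a column while adding a part `ℓ + 1` slides `Z` one place to the left. The new last
entry is `m - 1` because the total length is `m + 1 + ℓ`. The domain condition `γ_1 ≤ ℓ + 2` is the
bound on the last entry. -/
theorem nuOne_ramp {m : ℕ} (hm : 1 ≤ m) {Z : List ℤ} (hu : IsDyck (ramp (m + 1) ++ Z))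
    (hZ : Z ≠ []) (hh : ∀ x ∈ Z.head?, x ≤ m) (hl : ∀ x ∈ Z.getLast?, (m : ℤ) - 2 ≤ x) :
    IsDyck (ramp m ++ (Z ++ [(m : ℤ) - 1])) ∧
      nuOne (cls (ramp (m + 1) ++ Z)) = some (cls (ramp m ++ (Z ++ [(m : ℤ) - 1]))) := by
  have hw : IsQDV (ramp m ++ (Z ++ [(m : ℤ) - 1])) := by
    have h1 := ((isQDV_append (by omega)).1 hu.1).1
    rw [isQDV_append hm, List.isChain_append]
    refine ⟨⟨h1, List.isChain_singleton _, fun x hx y hy => ?_⟩, fun x hx => hh x ?_⟩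
    · have := hl x hx
      simp at hy
      omega
    · rwa [List.head?_append_of_ne_nil _ hZ] at hx
  refine ⟨⟨hw, ?_⟩, ?_⟩
  · have := hu.2
    rw [ramp_succ] at this
    intro x hx
    simp only [List.mem_append, List.mem_singleton] at hx this
    rcases hx with hx | hx | hx
    · exact this x (.inl (.inl hx))
    · exact this x (.inr hx)
    · omega
  · have hcol := colLen_cls hu.1 hZ (fun x hx => by have := hh x hx; push_cast; omega)
    obtain ⟨Y, x, rfl⟩ : ∃ Y x, Z = Y ++ [x] := ⟨_, _, (List.dropLast_append_getLast hZ).symm⟩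
    have hx : (m : ℤ) - 2 ≤ x := hl x (by simp)
    have hrow := rowLen_zero_cls (v := ramp (m + 1) ++ Y) (x := x) (by simpa using hu.1)
    simp only [List.append_assoc, List.length_append, length_ramp] at hrow hcol
    rw [nuOne, dif_pos (by rw [hcol]; simp; push_cast at hrow; omega)]
    congr 1
    refine eq_of_rowLen_eq fun k => ?_
    rw [rowLen_ofRowLens_getD]
    cases k with
    | zero =>
      have h2 := rowLen_zero_cls (v := ramp m ++ (Y ++ [x])) (x := (m : ℤ) - 1) (by simpa using hw)
      simp only [List.append_assoc, List.length_append, length_ramp] at h2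
      simp only [List.append_assoc]
      rw [List.getD_cons_zero, hcol]
      push_cast at h2 ⊢
      simp at h2 ⊢
      omega
    | succ k =>
      have e : (List.map (· - 1) (cls (ramp (m + 1) ++ (Y ++ [x]))).rowLens).getD k 0 =
          (cls (ramp (m + 1) ++ (Y ++ [x]))).rowLen k - 1 := by
        rcases lt_or_ge k ((cls (ramp (m + 1) ++ (Y ++ [x]))).colLen 0) with hk | hk
        · rw [List.getD_eq_getElem _ _ (by simpa using hk)]
          simp [YoungDiagram.rowLens]
        · rw [List.getD_eq_default _ _ (by simpa using hk)]
          have := mt lt_colLen_zero.2 (not_lt.2 hk)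
          omega
      rw [List.getD_cons_succ, e]
      set Z := Y ++ [x]
      have hlen : (ramp m ++ (Z ++ [(m : ℤ) - 1])).length = (ramp (m + 1) ++ Z).length := by
        simp [length_ramp]; omega
      rcases lt_or_ge (k + 1) (ramp (m + 1) ++ Z).length with hk | hk
      · have h1 := rowLen_cls hu.1 (k := k) (by omega)
        have h2 := rowLen_cls hw (k := k + 1) (by omega)
        rw [hlen] at h2
        rw [List.length_append, length_ramp] at h1 h2 hk
        rcases lt_or_ge k Z.length with hkZ | hkZ
        · rw [getD_ramp_append_right (by omega)] at h1 h2
          rw [List.getD_append _ _ _ _ (by omega),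
            show m + 1 + Z.length - 1 - (k + 1) - m = m + 1 + Z.length - 1 - k - (m + 1) by omega]
            at h2
          omega
        · rw [getD_ramp_append (by omega)] at h1 h2
          omega
      · rw [rowLen_cls_of_length_le hw (by omega)]
        rcases lt_or_ge k (ramp (m + 1) ++ Z).length with hk' | hk'
        · have h1 := rowLen_cls hu.1 hk'
          rw [show (ramp (m + 1) ++ Z).length - 1 - k = 0 by omega, hu.1.getD_zero] at h1
          push_cast at h1
          omega
        · rw [rowLen_cls_of_length_le hu.1 hk']

theorem nuOne_ramp_eq_none {m : ℕ} {Z : List ℤ} {x : ℤ} (hu : IsQDV (ramp (m + 1) ++ (Z ++ [x])))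
    (hh : ∀ y ∈ (Z ++ [x]).head?, y ≤ m) (hx : x < (m : ℤ) - 2) :
    nuOne (cls (ramp (m + 1) ++ (Z ++ [x]))) = none := by
  have hcol := colLen_cls hu (by simp) (fun x hx => by have := hh x hx; push_cast; omega)
  have hrow := rowLen_zero_cls (v := ramp (m + 1) ++ Z) (x := x) (by simpa using hu)
  simp only [List.append_assoc, List.length_append, length_ramp] at hrow
  rw [nuOne, dif_neg]
  rw [hcol]
  simp
  push_cast at hrow
  omega

theorem nu_eq_of_nuOne {γ δ : YoungDiagram} (h : nuOne γ = some δ) : nu γ = some δ := by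
  simp [nu, h]

theorem nu_eq_of_nuTwoRel {γ δ : YoungDiagram} (h : nuOne γ = none) (h2 : NuTwoRel γ δ) :
    nu γ = some δ := by
  rw [nu, h, nuTwo_eq_some_iff.2 h2, Option.none_or]

theorem nu_ramp {m : ℕ} (hm : 1 ≤ m) {Z : List ℤ} (hu : IsDyck (ramp (m + 1) ++ Z))
    (hZ : Z ≠ []) (hh : ∀ x ∈ Z.head?, x ≤ m) (hl : ∀ x ∈ Z.getLast?, (m : ℤ) - 2 ≤ x) :
    IsDyck (ramp m ++ (Z ++ [(m : ℤ) - 1])) ∧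
      nu (cls (ramp (m + 1) ++ Z)) = some (cls (ramp m ++ (Z ++ [(m : ℤ) - 1]))) ∧
      ¬ IsInitial (cls (ramp m ++ (Z ++ [(m : ℤ) - 1]))) := by
  obtain ⟨h1, h2⟩ := nuOne_ramp hm hu hZ hh hl
  exact ⟨h1, nu_eq_of_nuOne h2, not_isInitial_cls h1.1 (by omega)⟩

theorem ramp_one (Z : List ℤ) : ramp 1 ++ Z = 0 :: Z := by
  simp [ramp]

theorem ramp_two (Z : List ℤ) : ramp 2 ++ Z = 0 :: 1 :: Z := by
  simp [ramp, List.range_succ]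

theorem ramp_three (Z : List ℤ) : ramp 3 ++ Z = 0 :: 1 :: 2 :: Z := by
  simp [ramp, List.range_succ]

theorem ramp_four (Z : List ℤ) : ramp 4 ++ Z = 0 :: 1 :: 2 :: 3 :: Z := by
  simp [ramp, List.range_succ]

theorem nu_one {Z : List ℤ} (hu : IsDyck (0 :: 1 :: Z)) (hZ : Z ≠ [])
    (hh : ∀ x ∈ Z.head?, x ≤ 1) :
    IsDyck (0 :: (Z ++ [0])) ∧ nu (cls (0 :: 1 :: Z)) = some (cls (0 :: (Z ++ [0]))) ∧
      ¬ IsInitial (cls (0 :: (Z ++ [0]))) := by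
  have h := nu_ramp (m := 1) le_rfl (Z := Z) (by rwa [ramp_two]) hZ (by simpa using hh)
    (fun x hx => by
      have := hu.2 x (by simp [List.mem_of_getLast? hx])
      push_cast
      omega)
  simpa only [ramp_two, ramp_one, Nat.reduceAdd, Nat.cast_one, sub_self] using h

theorem nu_two {Z : List ℤ} (hu : IsDyck (0 :: 1 :: 2 :: Z)) (hZ : Z ≠ [])
    (hh : ∀ x ∈ Z.head?, x ≤ 2) :
    IsDyck (0 :: 1 :: (Z ++ [1])) ∧
      nu (cls (0 :: 1 :: 2 :: Z)) = some (cls (0 :: 1 :: (Z ++ [1]))) ∧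
      ¬ IsInitial (cls (0 :: 1 :: (Z ++ [1]))) := by
  have h := nu_ramp (m := 2) (by omega) (Z := Z) (by rwa [ramp_three]) hZ (by simpa using hh)
    (fun x hx => by
      have := hu.2 x (by simp [List.mem_of_getLast? hx])
      push_cast
      omega)
  simpa only [ramp_three, ramp_two, Nat.reduceAdd, Nat.cast_ofNat, show (2 : ℤ) - 1 = 1 by rfl] using h

theorem nu_three {Z : List ℤ} (hu : IsDyck (0 :: 1 :: 2 :: 3 :: Z)) (hZ : Z ≠ [])
    (hh : ∀ x ∈ Z.head?, x ≤ 3) (hl : ∀ x ∈ Z.getLast?, 1 ≤ x) :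
    IsDyck (0 :: 1 :: 2 :: (Z ++ [2])) ∧
      nu (cls (0 :: 1 :: 2 :: 3 :: Z)) = some (cls (0 :: 1 :: 2 :: (Z ++ [2]))) ∧
      ¬ IsInitial (cls (0 :: 1 :: 2 :: (Z ++ [2]))) := by
  have h := nu_ramp (m := 3) (by omega) (Z := Z) (by rwa [ramp_four]) hZ (by simpa using hh)
    (fun x hx => by
      have := hl x hx
      push_cast
      omega)
  simpa only [ramp_four, ramp_three, Nat.reduceAdd, Nat.cast_ofNat, show (3 : ℤ) - 1 = 2 by rfl] using h

/-! ### Runs of `NU₁` at constant length. -/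

theorem nuIter_add {γ δ : YoungDiagram} {t : ℕ} (h : nuIter γ t = some δ) (s : ℕ) :
    nuIter γ (t + s) = nuIter δ s := by
  rw [nuIter, Nat.add_comm, Function.iterate_add_apply, nuIter]
  exact congrArg _ h

/-- A reduced Dyck vector of length `N` that starts with `01` and is not `NU₁`-initial. -/
def IsFlat (N : ℕ) (w : List ℤ) : Prop :=
  IsDyck w ∧ 0 ∈ w.tail ∧ (∃ Y, w = 0 :: 1 :: Y) ∧ w.length = N ∧ ¬ IsInitial (cls w)

/-- The chain leads in `n` steps from `[u]` to `[w]`, and all objects before `[w]` have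
reduced vectors as in `IsFlat`. -/
def FlatRun (N n : ℕ) (u w : List ℤ) : Prop :=
  (∀ o < n, ∃ x, IsFlat N x ∧ nuIter (cls u) o = some (cls x)) ∧
    nuIter (cls u) n = some (cls w)

theorem FlatRun.refl (N : ℕ) (u : List ℤ) : FlatRun N 0 u u :=
  ⟨fun _ h => (Nat.not_lt_zero _ h).elim, rfl⟩

theorem FlatRun.cons {N n : ℕ} {u u' w : List ℤ} (hu : IsFlat N u)
    (h : nu (cls u) = some (cls u')) (hr : FlatRun N n u' w) : FlatRun N (n + 1) u w := by
  have h1 : nuIter (cls u) 1 = some (cls u') := h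
  refine ⟨fun o ho => ?_, ?_⟩
  · cases o with
    | zero => exact ⟨u, hu, rfl⟩
    | succ o =>
      obtain ⟨x, hx, hx'⟩ := hr.1 o (by omega)
      exact ⟨x, hx, by rw [Nat.add_comm, nuIter_add h1, hx']⟩
  · rw [Nat.add_comm, nuIter_add h1, hr.2]

theorem FlatRun.trans {N m n : ℕ} {u w x : List ℤ} (h : FlatRun N m u w) (h' : FlatRun N n w x) :
    FlatRun N (m + n) u x := by
  refine ⟨fun o ho => ?_, by rw [nuIter_add h.2, h'.2]⟩
  rcases lt_or_ge o m with hm | hm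
  · exact h.1 o hm
  · obtain ⟨y, hy, hy'⟩ := h'.1 (o - m) (by omega)
    refine ⟨y, hy, ?_⟩
    rw [show o = m + (o - m) by omega, nuIter_add h.2, hy']

/-- The list obtained by adding `1` to each entry. -/
def inc (X : List ℤ) : List ℤ :=
  X.map (· + 1)

@[simp] theorem inc_nil : inc [] = [] := rfl

@[simp] theorem inc_cons (x : ℤ) (X : List ℤ) : inc (x :: X) = (x + 1) :: inc X := rfl

@[simp] theorem inc_append (X Y : List ℤ) : inc (X ++ Y) = inc X ++ inc Y := List.map_append

@[simp] theorem length_inc (X : List ℤ) : (inc X).length = X.length := List.length_map _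

/-- Each step takes one entry of `inc E` from behind `01` and puts it, lowered by 1, at the end: a
`1` extends no ramp and appends 0, a `2` extends the ramp and appends 1. When `E` is exhausted, the
vector begins with `010`, and one more step produces `00`. -/
theorem flatRun_low {E : List ℤ} (hE : ∀ x ∈ E, x = 0 ∨ x = 1) {N : ℕ} {U : List ℤ}
    (hu : IsDyck (0 :: 1 :: (inc E ++ 0 :: U)))
    (hi : ¬ IsInitial (cls (0 :: 1 :: (inc E ++ 0 :: U)))) (hN : N = E.length + U.length + 3) :
    FlatRun N (E.length + 1) (0 :: 1 :: (inc E ++ 0 :: U)) (0 :: 0 :: (U ++ (E ++ [0]))) ∧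
      ¬ IsInitial (cls (0 :: 0 :: (U ++ (E ++ [0])))) := by
  induction E generalizing U with
  | nil =>
    simp only [inc_nil, List.nil_append] at hu hi ⊢
    obtain ⟨-, h2, h3⟩ := nu_one hu (by simp) (by simp)
    refine ⟨FlatRun.cons ⟨hu, by simp, ⟨_, rfl⟩, by simp [hN], hi⟩ h2 (FlatRun.refl _ _), h3⟩
  | cons x E ih =>
    have hE' : ∀ x ∈ E, x = 0 ∨ x = 1 := fun y hy => hE y (by simp [hy])
    have hflat : IsFlat N (0 :: 1 :: (inc (x :: E) ++ 0 :: U)) :=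
      ⟨hu, by simp, ⟨_, rfl⟩, by simp [hN]; omega, hi⟩
    rcases hE x (by simp) with rfl | rfl
    · simp only [inc_cons, List.cons_append, zero_add] at hu hi ⊢
      obtain ⟨h1, h2, h3⟩ := nu_one hu (by simp) (by simp)
      simp only [List.cons_append, List.append_assoc] at h1 h2 h3
      obtain ⟨h4, h5⟩ := ih hE' h1 h3 (by simp [hN]; omega)
      simp only [List.append_assoc, List.cons_append, List.nil_append] at h4 h5
      exact ⟨FlatRun.cons hflat h2 h4, h5⟩
    · simp only [inc_cons, List.cons_append, show (1 : ℤ) + 1 = 2 by rfl] at hu hi ⊢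
      obtain ⟨h1, h2, h3⟩ := nu_two hu (by simp) (by
        cases E with
        | nil => simp
        | cons y E => rcases hE' y (by simp) with rfl | rfl <;> simp)
      simp only [List.cons_append, List.append_assoc] at h1 h2 h3
      obtain ⟨h4, h5⟩ := ih hE' h1 h3 (by simp [hN]; omega)
      simp only [List.append_assoc, List.cons_append, List.nil_append] at h4 h5
      exact ⟨FlatRun.cons hflat h2 h4, h5⟩

/-- The same rotation one level higher, behind `012`. A step that removes a `3` needs a last entry
at least 1. This is a condition on `V` only if the first symbol of `F` is 2, since later steps see
the 1 or 2 appended just before. -/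
theorem flatRun_high {F : List ℤ} (hF : ∀ x ∈ F, x = 1 ∨ x = 2) {N : ℕ} {V : List ℤ}
    (hV : 0 ∈ V) (hVh : ∀ x ∈ V.head?, x ≤ 2)
    (hFV : (∀ x ∈ F.head?, x = 1) ∨ ∀ x ∈ V.getLast?, 1 ≤ x)
    (hu : IsDyck (0 :: 1 :: 2 :: (inc F ++ V)))
    (hi : ¬ IsInitial (cls (0 :: 1 :: 2 :: (inc F ++ V)))) (hN : N = F.length + V.length + 3) :
    FlatRun N (F.length + 1) (0 :: 1 :: 2 :: (inc F ++ V)) (0 :: 1 :: (V ++ (F ++ [1]))) ∧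
      IsDyck (0 :: 1 :: (V ++ (F ++ [1]))) ∧
      ¬ IsInitial (cls (0 :: 1 :: (V ++ (F ++ [1])))) := by
  induction F generalizing V with
  | nil =>
    simp only [inc_nil, List.nil_append] at hu hi ⊢
    obtain ⟨h1, h2, h3⟩ := nu_two hu (List.ne_nil_of_mem hV) hVh
    refine ⟨FlatRun.cons ⟨hu, by simp [hV], ⟨_, rfl⟩, by simp [hN], hi⟩ h2 (FlatRun.refl _ _),
      h1, h3⟩
  | cons x F ih =>
    have hF' : ∀ x ∈ F, x = 1 ∨ x = 2 := fun y hy => hF y (by simp [hy])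
    have hVn := List.ne_nil_of_mem hV
    have hflat : IsFlat N (0 :: 1 :: 2 :: (inc (x :: F) ++ V)) :=
      ⟨hu, by simp [hV], ⟨_, rfl⟩, by simp [hN]; omega, hi⟩
    have hVh' : ∀ a, ∀ x ∈ (V ++ [a]).head?, x ≤ 2 := fun a => by
      rwa [List.head?_append_of_ne_nil _ hVn]
    rcases hF x (by simp) with rfl | rfl
    · simp only [inc_cons, List.cons_append, show (1 : ℤ) + 1 = 2 by rfl] at hu hi ⊢
      obtain ⟨h1, h2, h3⟩ := nu_two hu (by simp) (by simp)
      simp only [List.cons_append, List.append_assoc] at h1 h2 h3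
      obtain ⟨h4, h5, h6⟩ := ih (V := V ++ [1]) hF' (by simp [hV]) (hVh' 1) (.inr (by simp)) h1 h3
        (by simp [hN]; omega)
      simp only [List.append_assoc, List.cons_append, List.nil_append] at h4 h5 h6
      exact ⟨FlatRun.cons hflat h2 h4, h5, h6⟩
    · simp only [inc_cons, List.cons_append, show (2 : ℤ) + 1 = 3 by rfl] at hu hi ⊢
      obtain ⟨h1, h2, h3⟩ := nu_three hu (by simp [hVn])
        (by
          cases F with
          | nil => exact fun y hy => (hVh y hy).trans (by omega)
          | cons y F => rcases hF' y (by simp) with rfl | rfl <;> simp)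
        (by
          rcases hFV with h | h
          · simp at h
          · rwa [List.getLast?_append_of_ne_nil _ hVn])
      simp only [List.append_assoc] at h1 h2 h3
      obtain ⟨h4, h5, h6⟩ := ih (V := V ++ [2]) hF' (by simp [hV]) (hVh' 2) (.inr (by simp)) h1 h3
        (by simp [hN]; omega)
      simp only [List.append_assoc, List.cons_append, List.nil_append] at h4 h5 h6
      exact ⟨FlatRun.cons hflat h2 h4, h5, h6⟩

/-! ### States and the map `next` on them. -/

/-- The word `1 2^{a_1} 1 2^{a_2} ⋯` for a list of exponents `a_1, a_2, …`. -/
def word (l : List ℕ) : List ℤ :=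
  l.flatMap fun a => 1 :: List.replicate a 2

/-- The vector `0 0 1 2^{a_1} 1 2^{a_2} ⋯ D`. -/
def vec (s : List ℕ × List ℤ) : List ℤ :=
  0 :: 0 :: (word s.1 ++ s.2)

/-- The next vector of the form `vec s` in the chain. -/
def next : List ℕ × List ℤ → List ℕ × List ℤ
  | ([], D) => ([], D ++ [0])
  | (0 :: l, D) => (l, 1 :: (D ++ [0]))
  | (1 :: l, D) => (l, D ++ [0, 1])
  | ((a + 2) :: l, D) => (a :: l, D ++ [1, 1])

/-- The word starts with `12`. -/
def Drops (s : List ℕ × List ℤ) : Prop :=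
  s.1.headD 0 ≠ 0

instance (s : List ℕ × List ℤ) : Decidable (Drops s) :=
  inferInstanceAs (Decidable (_ ≠ _))

/-- The number of steps in the chain from `[vec s]` to `[vec (next s)]`. -/
def blockLen (s : List ℕ × List ℤ) : ℕ :=
  if Drops s then 2 else (vec s).length

/-- The second component consists of zeros and ones. -/
def Binary (s : List ℕ × List ℤ) : Prop :=
  ∀ x ∈ s.2, x = 0 ∨ x = 1

@[elab_as_elim] theorem next_cases {P : List ℕ × List ℤ → Prop} (h0 : ∀ D, P ([], D)) (h1 : ∀ l D, P (0 :: l, D))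
    (h2 : ∀ l D, P (1 :: l, D)) (h3 : ∀ a l D, P ((a + 2) :: l, D)) (s) : P s := by
  obtain ⟨l, D⟩ := s
  match l with
  | [] => exact h0 D
  | 0 :: l => exact h1 l D
  | 1 :: l => exact h2 l D
  | (a + 2) :: l => exact h3 a l D

theorem Binary.next {s : List ℕ × List ℤ} : Binary s → Binary (next s) := by
  refine next_cases ?_ ?_ ?_ ?_ s
  · intro D h x hx
    simp [DyckChain.next] at hx
    rcases hx with hx | hx
    · exact h x hx
    · exact .inl hx
  · intro l D h x hx
    simp [DyckChain.next] at hx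
    rcases hx with hx | hx | hx
    · exact .inr hx
    · exact h x hx
    · exact .inl hx
  · intro l D h x hx
    simp [DyckChain.next] at hx
    rcases hx with hx | hx
    · exact h x hx
    · exact hx
  · intro a l D h x hx
    simp [DyckChain.next] at hx
    rcases hx with hx | hx
    · exact h x hx
    · exact .inr hx

@[simp] theorem word_nil : word [] = [] := rfl

@[simp] theorem word_cons (a : ℕ) (l : List ℕ) :
    word (a :: l) = 1 :: (List.replicate a 2 ++ word l) := rfl

theorem mem_word {l : List ℕ} : ∀ x ∈ word l, x = 1 ∨ x = 2 := by
  intro x hx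
  simp only [word, List.mem_flatMap, List.mem_cons, List.mem_replicate] at hx
  obtain ⟨a, -, h | ⟨-, h⟩⟩ := hx
  · exact .inl h
  · exact .inr h

theorem head_word {l : List ℕ} : ∀ x ∈ (word l).head?, x = 1 := by
  cases l with
  | nil => simp
  | cons a l =>
    intro x hx
    simp at hx
    omega

theorem isChain_of_mem {a : ℤ} {X : List ℤ} (h : ∀ x ∈ X, x = a ∨ x = a + 1) :
    X.IsChain fun a b => b ≤ a + 1 := by
  rw [List.isChain_iff_getElem]
  intro i hi
  have h1 := h X[i] (List.getElem_mem _)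
  have h2 := h X[i + 1] (List.getElem_mem _)
  omega

theorem isChain_tail {X D : List ℤ} (hX : ∀ x ∈ X, x = 1 ∨ x = 2) (hD : ∀ x ∈ D, x = 0 ∨ x = 1) :
    (X ++ D).IsChain fun a b => b ≤ a + 1 := by
  rw [List.isChain_append]
  refine ⟨isChain_of_mem (a := 1) hX, isChain_of_mem (a := 0) hD, fun x hx y hy => ?_⟩
  have h1 := hX x (List.mem_of_getLast? hx)
  have h2 := hD y (List.mem_of_head? hy)
  omega

theorem isDyck_vec {s : List ℕ × List ℤ} (hs : Binary s) : IsDyck (vec s) := by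
  obtain ⟨l, D⟩ := s
  refine ⟨⟨rfl, ?_⟩, fun x hx => ?_⟩
  · have h : ∀ x ∈ (word l ++ D).head?, x ≤ 1 := by
      intro x hx
      rw [List.head?_append, Option.mem_def, Option.or_eq_some_iff] at hx
      rcases hx with hx | ⟨-, hx⟩
      · rw [head_word x hx]
      · have := hs x (List.mem_of_head? hx)
        omega
    rw [vec, List.isChain_cons, List.isChain_cons]
    exact ⟨by simp, by simpa using h, isChain_tail mem_word hs⟩
  · simp only [vec, List.mem_cons, List.mem_append] at hx
    rcases hx with rfl | rfl | hx | hx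
    · rfl
    · rfl
    · have := mem_word x hx
      omega
    · have := hs x hx
      omega

theorem mind_vec {s : List ℕ × List ℤ} (hs : Binary s) : mind (cls (vec s)) = (vec s).length :=
  mind_cls (isDyck_vec hs) (by simp [vec])

theorem reduced_vec {s : List ℕ × List ℤ} (hs : Binary s) : reduced (cls (vec s)) = vec s :=
  reduced_cls (isDyck_vec hs) (by simp [vec])

/-! ### One block of the chain, from `[vec s]` to `[vec (next s)]`. -/

/-- The first step after a vector that starts with `00`. -/
theorem nu_zero_zero {X : List ℤ} (h : IsDyck (0 :: 0 :: X)) :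
    nu (cls (0 :: 0 :: X)) = some (cls (0 :: 1 :: (inc X ++ [0]))) ∧
      IsFlat (X.length + 3) (0 :: 1 :: (inc X ++ [0])) := by
  -- The representative of `[00X]` that is one longer is `0 1 1 X⁺`; it starts with a ramp of length
  -- 2, so the `NU₁` step deletes its first 1 and appends 0.
  have hsh := cls_shift h.1
  have hd : IsDyck (0 :: 1 :: 1 :: inc X) := by
    constructor
    · have hc := h.1.2
      rw [List.isChain_cons] at hc
      refine ⟨rfl, ?_⟩
      rw [List.isChain_cons]
      refine ⟨by simp, ?_⟩
      have : (1 :: 1 :: inc X : List ℤ) = (0 :: 0 :: X).map (· + 1) := rfl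
      rw [this, List.isChain_map]
      exact h.1.2.imp fun a b hab => by omega
    · intro x hx
      simp only [List.mem_cons, inc, List.mem_map] at hx
      rcases hx with rfl | rfl | rfl | ⟨y, hy, rfl⟩
      · omega
      · omega
      · omega
      · have := h.2 y (by simp [hy])
        omega
  obtain ⟨h1, h2, h3⟩ := nu_one hd (by simp) (by simp)
  exact ⟨by rw [← hsh]; exact h2, h1, by simp, ⟨_, rfl⟩, by simp, h3⟩

theorem length_vec (s : List ℕ × List ℤ) : (vec s).length = (word s.1).length + s.2.length + 2 := by
  simp [vec]

/-- With an empty word, `flatRun_low` alone rotates `D`. With first exponent 0, `flatRun_high`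
carries the remaining word to the end and then `flatRun_low` carries `D`, which brings the word back
in front of `D`. -/
theorem flatRun_of_not_drops {s : List ℕ × List ℤ} (hs : Binary s) (hd : ¬ Drops s) :
    FlatRun ((vec s).length + 1) ((vec s).length - 1) (0 :: 1 :: (inc (word s.1 ++ s.2) ++ [0]))
      (vec (next s)) ∧ ¬ IsInitial (cls (vec (next s))) := by
  obtain ⟨-, hfl⟩ := nu_zero_zero (isDyck_vec hs)
  revert hs hd hfl
  refine next_cases ?_ ?_ ?_ ?_ s
  · intro D hs _ hfl
    obtain ⟨h1, h2⟩ := flatRun_low (E := D) hs (U := []) hfl.1 hfl.2.2.2.2 rfl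
    simp only [length_vec]
    simpa [vec, next] using ⟨h1, h2⟩
  · intro l D hs _ hfl
    have e : (0 :: 1 :: (inc (word (0 :: l) ++ D) ++ [0]) : List ℤ) =
        0 :: 1 :: 2 :: (inc (word l) ++ (inc D ++ [0])) := by simp
    simp only [e] at hfl ⊢
    obtain ⟨h1, h2, h3⟩ := flatRun_high (F := word l) mem_word (V := inc D ++ [0]) (by simp)
      (by
        intro x hx
        have := List.mem_of_head? hx
        simp only [inc, List.mem_append, List.mem_map, List.mem_singleton] at this
        rcases this with ⟨y, hy, rfl⟩ | rfl
        · have := hs y hy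
          omega
        · omega)
      -- The vector ends in 0 here, but the remaining word starts with 1, so a 1 is appended before
      -- any `3` has to be removed.
      (.inl head_word) hfl.1 hfl.2.2.2.2 rfl
    rw [List.append_assoc, List.singleton_append] at h1 h2 h3
    obtain ⟨h4, h5⟩ := flatRun_low (E := D) hs h2 h3 rfl
    have h6 := h1.trans (N := (word l).length + (inc D ++ [0]).length + 3)
      (by convert h4 using 1; simp; omega)
    simp only [length_vec]
    refine ⟨?_, ?_⟩
    · convert h6 using 1
      · simp; omega
      · simp; omega
      · simp [vec, next]
    · convert h5 using 3
      simp [vec, next]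
  · intro l D _ hd
    simp [Drops] at hd
  · intro a l D _ hd
    simp [Drops] at hd

/-- `NU₂` applied to a flat vector whose shift ends in `-1`. -/
theorem nu_of_rule {Y w : List ℤ} (hY : Y.IsChain fun a b => b ≤ a + 1) (hh : ∀ x ∈ Y.head?, x ≤ 2)
    (hl : ∀ x ∈ Y.getLast?, 0 ≤ x)
    (hr : RuleA (0 :: 1 :: 2 :: (Y ++ [-1])) w ∨ RuleB (0 :: 1 :: 2 :: (Y ++ [-1])) w)
    (hw : IsQDV w) :
    nu (cls (0 :: 1 :: 2 :: 3 :: (inc Y ++ [0]))) = some (cls w) := by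
  have hv : IsQDV (0 :: 1 :: 2 :: (Y ++ [-1])) := by
    rw [← ramp_three, isQDV_append (by omega), List.isChain_append]
    refine ⟨⟨hY, List.isChain_singleton _, fun x hx y hy => ?_⟩, fun x hx => ?_⟩
    · have := hl x hx
      simp at hy
      omega
    · rw [List.head?_append, Option.mem_def, Option.or_eq_some_iff] at hx
      rcases hx with hx | ⟨-, hx⟩
      · have := hh x hx
        push_cast
        omega
      · simp at hx
        push_cast
        omega
  have e : (0 :: 1 :: 2 :: 3 :: (inc Y ++ [0]) : List ℤ) =
      0 :: (0 :: 1 :: 2 :: (Y ++ [-1])).map (· + 1) := by simp [inc]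
  have hq : IsQDV (0 :: 1 :: 2 :: 3 :: (inc Y ++ [0])) := by
    rw [e]
    refine ⟨rfl, ?_⟩
    rw [List.isChain_cons]
    refine ⟨by simp, ?_⟩
    rw [List.isChain_map]
    exact hv.2.imp fun a b hab => by omega
  refine nu_eq_of_nuTwoRel ?_ ⟨_, w, hr, hv, hw, by rw [e, cls_shift hv], rfl⟩
  have := nuOne_ramp_eq_none (m := 3) (Z := inc Y) (x := 0) (by rw [ramp_four]; exact hq) (by
    intro x hx
    rw [List.head?_append, Option.mem_def, Option.or_eq_some_iff] at hx
    rcases hx with hx | ⟨-, hx⟩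
    · rw [inc, List.head?_map, Option.map_eq_some_iff] at hx
      obtain ⟨y, hy, rfl⟩ := hx
      have := hh y hy
      push_cast
      omega
    · simp at hx
      push_cast
      omega) (by norm_num)
  rwa [ramp_four] at this

theorem mem_bounds {l : List ℕ} {k : ℕ} {D : List ℤ} (hD : ∀ x ∈ D, x = 0 ∨ x = 1) :
    ∀ x ∈ List.replicate k 2 ++ (word l ++ D), 0 ≤ x ∧ x ≤ 2 := by
  intro x hx
  simp only [List.mem_append, List.mem_replicate] at hx
  rcases hx with ⟨-, rfl⟩ | hx | hx
  · omega
  · have := mem_word x hx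
    omega
  · have := hD x hx
    omega

theorem nu_of_drops {s : List ℕ × List ℤ} (hs : Binary s) (hd : Drops s) :
    nu (cls (0 :: 1 :: (inc (word s.1 ++ s.2) ++ [0]))) = some (cls (vec (next s))) ∧
      IsInitial (cls (vec (next s))) := by
  have hn := isDyck_vec hs.next
  revert hs hd hn
  refine next_cases ?_ ?_ ?_ ?_ s
  · intro D _ hd
    simp [Drops] at hd
  · intro l D _ hd
    simp [Drops] at hd
  · intro l D hs _ hn
    have hb := mem_bounds (l := l) (k := 0) hs
    simp only [List.replicate_zero, List.nil_append] at hb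
    have hc := isChain_tail (mem_word (l := l)) hs
    have hh : ∀ x ∈ (word l ++ D).head?, x ≤ 1 := by
      intro x hx
      rw [List.head?_append, Option.mem_def, Option.or_eq_some_iff] at hx
      rcases hx with hx | ⟨-, hx⟩
      · rw [head_word x hx]
      · have := hs x (List.mem_of_head? hx)
        omega
    constructor
    · have := nu_of_rule (Y := word l ++ D) (w := vec (next (1 :: l, D))) hc
        (fun x hx => (hb x (List.mem_of_head? hx)).2)
        (fun x hx => (hb x (List.mem_of_getLast? hx)).1)
        -- Rule (ii) with `k = 1`: the exponent 1 leaves a `B` whose first entry is at most 1.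
        (.inr ⟨1, word l ++ D, le_rfl, fun x hx => (hb x hx).2, hh,
          fun x hx => by have := (hb x (List.mem_of_getLast? hx)).1; omega, hc,
          by simp, by simp [vec, next]⟩) hn.1
      simpa using this
    · have e : vec (next (1 :: l, D)) = 0 :: 0 :: ((word l ++ D ++ [0]) ++ [1]) := by
        simp [vec, next]
      rw [e] at hn ⊢
      exact isInitial_cls hn.1 le_rfl
  · intro a l D hs _ hn
    have hb := mem_bounds (l := l) (k := a) hs
    have hc : (List.replicate a 2 ++ (word l ++ D)).IsChain (fun a b => b ≤ a + 1) := by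
      rw [← List.append_assoc]
      refine isChain_tail (fun x hx => ?_) hs
      rw [List.mem_append, List.mem_replicate] at hx
      rcases hx with ⟨-, rfl⟩ | hx
      · exact .inr rfl
      · exact mem_word x hx
    constructor
    · have := nu_of_rule (Y := 2 :: (List.replicate a 2 ++ (word l ++ D)))
        (w := vec (next ((a + 2) :: l, D)))
        (by
          rw [List.isChain_cons]
          exact ⟨fun x hx => by have := (hb x (List.mem_of_head? hx)).2; omega, hc⟩)
        (by simp)
        (fun x hx => by
          have := List.mem_of_getLast? hx
          rw [List.mem_cons] at this
          rcases this with rfl | h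
          · omega
          · exact (hb x h).1)
        -- Rule (i) with `h = 2`: exactly one `-1` stands at the end, so only two of the 2's are
        -- used and the other `a` go into `A`.
        (.inl ⟨2, List.replicate a 2 ++ (word l ++ D), le_rfl, fun x hx => (hb x hx).2,
          fun x hx => (hb x (List.mem_of_getLast? hx)).1, hc,
          by simp [List.replicate_succ], by simp [vec, next, List.replicate_succ]⟩) hn.1
      simpa [List.replicate_succ] using this
    · have e : vec (next ((a + 2) :: l, D)) =
          0 :: 0 :: ((1 :: (List.replicate a 2 ++ (word l ++ (D ++ [1])))) ++ [1]) := by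
        simp [vec, next]
      rw [e] at hn ⊢
      exact isInitial_cls hn.1 le_rfl

theorem block {s : List ℕ × List ℤ} (hs : Binary s) :
    (∀ o, 0 < o → o < blockLen s →
      ∃ x, IsFlat ((vec s).length + 1) x ∧ nuIter (cls (vec s)) o = some (cls x)) ∧
    nuIter (cls (vec s)) (blockLen s) = some (cls (vec (next s))) ∧
    (IsInitial (cls (vec (next s))) ↔ Drops s) := by
  obtain ⟨h1, h2⟩ := nu_zero_zero (isDyck_vec hs)
  have h1' : nuIter (cls (vec s)) 1 = some (cls (0 :: 1 :: (inc (word s.1 ++ s.2) ++ [0]))) := h1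
  have hlen : (word s.1 ++ s.2).length + 3 = (vec s).length + 1 := by simp [length_vec]
  rw [hlen] at h2
  obtain ⟨h3, h4⟩ : FlatRun ((vec s).length + 1) (blockLen s - 1)
      (0 :: 1 :: (inc (word s.1 ++ s.2) ++ [0])) (vec (next s)) ∧
      (IsInitial (cls (vec (next s))) ↔ Drops s) := by
    by_cases hd : Drops s
    · obtain ⟨h5, h6⟩ := nu_of_drops hs hd
      rw [blockLen, if_pos hd]
      exact ⟨FlatRun.cons h2 h5 (FlatRun.refl _ _), by simp [h6, hd]⟩
    · obtain ⟨h5, h6⟩ := flatRun_of_not_drops hs hd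
      rw [blockLen, if_neg hd]
      exact ⟨h5, by simp [h6, hd]⟩
  have hpos : 1 ≤ blockLen s := by
    rw [blockLen, length_vec]
    split_ifs <;> omega
  refine ⟨fun o ho ho' => ?_, ?_, h4⟩
  · obtain ⟨x, hx, hx'⟩ := h3.1 (o - 1) (by omega)
    exact ⟨x, hx, by rw [show o = 1 + (o - 1) by omega, nuIter_add h1', hx']⟩
  · rw [show blockLen s = 1 + (blockLen s - 1) by omega, nuIter_add h1', h3.2]

theorem length_vec_next (s : List ℕ × List ℤ) :
    (vec (next s)).length = (vec s).length + if Drops s then 0 else 1 := by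
  induction s using next_cases with
  | h0 D => simp [length_vec, next, Drops]
  | h1 l D => simp [length_vec, next, Drops]; omega
  | h2 l D => simp [length_vec, next, Drops]; omega
  | h3 a l D => simp [length_vec, next, Drops]; omega

theorem sum_vec_next (s : List ℕ × List ℤ) :
    (vec (next s)).sum = (vec s).sum - if Drops s then 2 else 0 := by
  induction s using next_cases with
  | h0 D => simp [vec, next, Drops]
  | h1 l D => simp [vec, next, Drops]; ring
  | h2 l D => simp [vec, next, Drops]; ring
  | h3 a l D => simp [vec, next, Drops]; ring

/-- The last symbol decides: `next` appends a word ending in 1 when it drops and a single 0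
otherwise. -/
theorem isForm_vec_next {s : List ℕ × List ℤ} (hs : Binary s) :
    IsForm (vec (next s)) ↔ Drops s := by
  have key : ∀ (l : List ℕ) {D : List ℤ}, (∀ x ∈ D, x = 0 ∨ x = 1) →
      IsForm (vec (l, D ++ [1])) := by
    intro l D hD
    refine ⟨word l ++ D, fun x hx => ?_, by simp [vec]⟩
    rw [List.mem_append] at hx
    rcases hx with hx | hx
    · have := mem_word x hx
      tauto
    · have := hD x hx
      tauto
  have key' : ∀ (l : List ℕ) (D : List ℤ), ¬ IsForm (vec (l, D ++ [0])) := by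
    rintro l D ⟨X, -, h⟩
    have := congrArg List.getLast? h
    simp only [vec, ← List.append_assoc, ← List.cons_append, List.getLast?_concat] at this
    simp at this
  revert hs
  induction s using next_cases with
  | h0 D => simpa [next, Drops] using fun _ => key' [] D
  | h1 l D => simpa [next, Drops] using fun _ => key' l (1 :: D)
  | h2 l D =>
    intro hs
    have := key l (D := D ++ [0]) (fun x hx => by
      rw [List.mem_append, List.mem_singleton] at hx
      exact hx.elim (hs x) .inl)
    simpa [next, Drops] using this
  | h3 a l D =>
    intro hs
    have := key (a :: l) (D := D ++ [1]) (fun x hx => by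
      rw [List.mem_append, List.mem_singleton] at hx
      exact hx.elim (hs x) .inr)
    simpa [next, Drops] using this

/-- A bound for the number of indices at which the iterates of `next` drop. -/
def height (s : List ℕ × List ℤ) : ℕ :=
  (s.1.map (· + 1)).sum

/-- Each rule deletes a whole group or two of its 2's, and the weight `a + 1` makes even the removal
of an empty group count. Truncated subtraction covers the empty list. -/
theorem height_next (s : List ℕ × List ℤ) : height (next s) ≤ height s - 1 := by
  induction s using next_cases with
  | h0 D => simp [height, next]
  | h1 l D => simp [height, next]
  | h2 l D => simp [height, next]
  | h3 a l D => simp [height, next]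

theorem mem_vec_iff {s : List ℕ × List ℤ} (hs : Binary s) : 2 ∈ vec s ↔ ∃ a ∈ s.1, a ≠ 0 := by
  have h2 : ¬ (2 : ℤ) ∈ s.2 := fun h => by
    have := hs _ h
    omega
  simp [vec, word, h2]

/-! ### The whole chain as a concatenation of blocks. -/

/-- The `k`-th vector of the form `vec s` in the chain belongs to this state. -/
def orbit (s : List ℕ × List ℤ) (k : ℕ) : List ℕ × List ℤ :=
  next^[k] s

/-- The position in the chain of `[vec (orbit s k)]`. -/
def pos (s : List ℕ × List ℤ) (k : ℕ) : ℕ :=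
  ∑ j ∈ Finset.range k, blockLen (orbit s j)

theorem orbit_succ (s : List ℕ × List ℤ) (k : ℕ) : orbit s (k + 1) = next (orbit s k) :=
  Function.iterate_succ_apply' _ _ _

theorem orbit_add (s : List ℕ × List ℤ) (k m : ℕ) : orbit s (k + m) = orbit (orbit s k) m := by
  rw [orbit, Nat.add_comm, Function.iterate_add_apply]
  rfl

theorem pos_succ (s : List ℕ × List ℤ) (k : ℕ) :
    pos s (k + 1) = pos s k + blockLen (orbit s k) :=
  Finset.sum_range_succ _ _

theorem pos_zero (s : List ℕ × List ℤ) : pos s 0 = 0 := rfl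

theorem two_le_blockLen (s : List ℕ × List ℤ) : 2 ≤ blockLen s := by
  rw [blockLen, length_vec]
  split_ifs <;> omega

theorem pos_strictMono (s : List ℕ × List ℤ) : StrictMono (pos s) :=
  strictMono_nat_of_lt_succ fun k => by
    have := two_le_blockLen (orbit s k)
    rw [pos_succ]
    omega

theorem exists_eq_pos_add (s : List ℕ × List ℤ) (t : ℕ) :
    ∃ k o, o < blockLen (orbit s k) ∧ t = pos s k + o := by
  induction t with
  | zero => exact ⟨0, 0, by have := two_le_blockLen (orbit s 0); omega, rfl⟩
  | succ t ih =>
    obtain ⟨k, o, ho, rfl⟩ := ih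
    rcases lt_or_ge (o + 1) (blockLen (orbit s k)) with h | h
    · exact ⟨k, o + 1, h, rfl⟩
    · refine ⟨k + 1, 0, by have := two_le_blockLen (orbit s (k + 1)); omega, ?_⟩
      rw [pos_succ]
      omega

theorem Binary.orbit {s : List ℕ × List ℤ} (hs : Binary s) (k : ℕ) :
    Binary (orbit s k) := by
  induction k with
  | zero => exact hs
  | succ k ih =>
    rw [orbit_succ]
    exact ih.next

theorem exists_forall_not_drops (s : List ℕ × List ℤ) : ∃ K, ∀ k ≥ K, ¬ Drops (orbit s k) := by
  have h : ∀ k, height (orbit s k) ≤ height s - k := by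
    intro k
    induction k with
    | zero => exact le_rfl
    | succ k ih =>
      rw [orbit_succ]
      have := height_next (orbit s k)
      omega
  refine ⟨height s, fun k hk => ?_⟩
  have h0 : height (orbit s k) = 0 := by
    have := h k
    omega
  rcases hl : (orbit s k).1 with _ | ⟨a, l⟩
  · simp [Drops, hl]
  · simp [height, hl] at h0

theorem exists_drops {s : List ℕ × List ℤ} (h : ∃ a ∈ s.1, a ≠ 0) : ∃ m, Drops (orbit s m) := by
  obtain ⟨l, D⟩ := s
  induction l generalizing D with
  | nil => simp at h
  | cons a l ih =>
    cases a with
    | zero =>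
      obtain ⟨m, hm⟩ := ih (1 :: (D ++ [0])) (by simpa using h)
      exact ⟨m + 1, by rw [Nat.add_comm, orbit_add]; exact hm⟩
    | succ a => exact ⟨0, by simp [orbit, Drops]⟩

theorem exists_ne_zero_of_next {s : List ℕ × List ℤ} :
    (∃ a ∈ (next s).1, a ≠ 0) → ∃ a ∈ s.1, a ≠ 0 := by
  induction s using next_cases with
  | h0 D => simp [next]
  | h1 l D => simp [next]
  | h2 l D => simp [next]
  | h3 a l D => simp [next]

theorem exists_ne_zero_of_drops {s : List ℕ × List ℤ} {m : ℕ} (h : Drops (orbit s m)) :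
    ∃ a ∈ s.1, a ≠ 0 := by
  induction m generalizing s with
  | zero =>
    obtain ⟨l, D⟩ := s
    cases l with
    | nil => simp [orbit, Drops] at h
    | cons a l => exact ⟨a, by simp, by simpa [orbit, Drops] using h⟩
  | succ m ih =>
    rw [Nat.add_comm, orbit_add] at h
    exact exists_ne_zero_of_next (ih h)

/-- Empty groups in front are removed one by one until a nonzero exponent comes first, and `next`
never creates a nonzero exponent from zeros. -/
theorem two_mem_vec_orbit_iff {s : List ℕ × List ℤ} (hs : Binary s) (k : ℕ) :
    2 ∈ vec (orbit s k) ↔ ∃ m ≥ k, Drops (orbit s m) := by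
  rw [mem_vec_iff (hs.orbit k)]
  constructor
  · intro h
    obtain ⟨m, hm⟩ := exists_drops h
    exact ⟨k + m, by omega, by rwa [orbit_add]⟩
  · rintro ⟨m, hm, h⟩
    rw [show m = k + (m - k) by omega, orbit_add] at h
    exact exists_ne_zero_of_drops h

/-- The objects of the chain that starts at `γ`. -/
noncomputable def chain (γ : YoungDiagram) (t : ℕ) : YoungDiagram :=
  (nuIter γ t).getD ⊥

theorem nuIter_pos {s : List ℕ × List ℤ} (hs : Binary s) (k : ℕ) :
    nuIter (cls (vec s)) (pos s k) = some (cls (vec (orbit s k))) := by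
  induction k with
  | zero => rfl
  | succ k ih => rw [pos_succ, nuIter_add ih, orbit_succ, (block (hs.orbit k)).2.1]

theorem nuIter_pos_add {s : List ℕ × List ℤ} (hs : Binary s) {k o : ℕ} (h0 : 0 < o)
    (ho : o < blockLen (orbit s k)) :
    ∃ x, IsFlat ((vec (orbit s k)).length + 1) x ∧
      nuIter (cls (vec s)) (pos s k + o) = some (cls x) := by
  obtain ⟨x, hx, hx'⟩ := (block (hs.orbit k)).1 o h0 ho
  exact ⟨x, hx, by rw [nuIter_add (nuIter_pos hs k), hx']⟩

theorem nuIter_eq_chain {s : List ℕ × List ℤ} (hs : Binary s) (t : ℕ) :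
    nuIter (cls (vec s)) t = some (chain (cls (vec s)) t) := by
  obtain ⟨k, o, ho, rfl⟩ := exists_eq_pos_add s t
  rcases Nat.eq_zero_or_pos o with rfl | h0
  · rw [Nat.add_zero, chain, nuIter_pos hs]
    rfl
  · obtain ⟨x, -, hx⟩ := nuIter_pos_add hs h0 ho
    rw [chain, hx]
    rfl

theorem chain_pos {s : List ℕ × List ℤ} (hs : Binary s) (k : ℕ) :
    chain (cls (vec s)) (pos s k) = cls (vec (orbit s k)) := by
  rw [chain, nuIter_pos hs]
  rfl

theorem chain_pos_add {s : List ℕ × List ℤ} (hs : Binary s) {k o : ℕ} (h0 : 0 < o)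
    (ho : o < blockLen (orbit s k)) :
    ∃ x, IsFlat ((vec (orbit s k)).length + 1) x ∧ chain (cls (vec s)) (pos s k + o) = cls x := by
  obtain ⟨x, hx, hx'⟩ := nuIter_pos_add hs h0 ho
  exact ⟨x, hx, by rw [chain, hx']; rfl⟩

theorem mind_chain_pos {s : List ℕ × List ℤ} (hs : Binary s) (k : ℕ) :
    mind (chain (cls (vec s)) (pos s k)) = (vec (orbit s k)).length := by
  rw [chain_pos hs, mind_vec (hs.orbit k)]

theorem mind_chain_pos_add {s : List ℕ × List ℤ} (hs : Binary s) {k o : ℕ} (h0 : 0 < o)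
    (ho : o < blockLen (orbit s k)) :
    mind (chain (cls (vec s)) (pos s k + o)) = (vec (orbit s k)).length + 1 := by
  obtain ⟨x, hx, hx'⟩ := chain_pos_add hs h0 ho
  rw [hx', mind_cls hx.1 hx.2.1, hx.2.2.2.1]

theorem not_isInitial_chain_pos_add {s : List ℕ × List ℤ} (hs : Binary s) {k o : ℕ} (h0 : 0 < o)
    (ho : o < blockLen (orbit s k)) : ¬ IsInitial (chain (cls (vec s)) (pos s k + o)) := by
  obtain ⟨x, hx, hx'⟩ := chain_pos_add hs h0 ho
  rw [hx']
  exact hx.2.2.2.2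

theorem reduced_chain_pos_add {s : List ℕ × List ℤ} (hs : Binary s) {k o : ℕ} (h0 : 0 < o)
    (ho : o < blockLen (orbit s k)) :
    ∃ Y, reduced (chain (cls (vec s)) (pos s k + o)) = 0 :: 1 :: Y := by
  obtain ⟨x, hx, hx'⟩ := chain_pos_add hs h0 ho
  obtain ⟨Y, hY⟩ := hx.2.2.1
  exact ⟨Y, by rw [hx', reduced_cls hx.1 hx.2.1, hY]⟩

theorem reduced_chain_pos {s : List ℕ × List ℤ} (hs : Binary s) (k : ℕ) :
    reduced (chain (cls (vec s)) (pos s k)) = vec (orbit s k) := by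
  rw [chain_pos hs, reduced_vec (hs.orbit k)]

theorem isInitial_chain_pos_succ {s : List ℕ × List ℤ} (hs : Binary s) (k : ℕ) :
    IsInitial (chain (cls (vec s)) (pos s (k + 1))) ↔ Drops (orbit s k) := by
  rw [chain_pos hs, orbit_succ, (block (hs.orbit k)).2.2]

theorem isInitial_chain_iff {s : List ℕ × List ℤ} (hs : Binary s) {t : ℕ} (ht : 0 < t) :
    IsInitial (chain (cls (vec s)) t) ↔ ∃ k, Drops (orbit s k) ∧ t = pos s (k + 1) := by
  constructor
  · intro h
    obtain ⟨k, o, ho, rfl⟩ := exists_eq_pos_add s t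
    rcases Nat.eq_zero_or_pos o with rfl | h0
    · cases k with
      | zero => simp [pos_zero] at ht
      | succ k => exact ⟨k, (isInitial_chain_pos_succ hs k).1 h, rfl⟩
    · exact (not_isInitial_chain_pos_add hs h0 ho h).elim
  · rintro ⟨k, hk, rfl⟩
    exact (isInitial_chain_pos_succ hs k).2 hk

/-- Within a block `mind` never decreases, so it can only fall at the entry to the next block: from
`L + 1` to `L` after a drop, while without a drop it stays at `L + 1`. -/
theorem isInitial_chain_succ_iff {s : List ℕ × List ℤ} (hs : Binary s) (t : ℕ) :
    IsInitial (chain (cls (vec s)) (t + 1)) ↔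
      mind (chain (cls (vec s)) (t + 1)) < mind (chain (cls (vec s)) t) := by
  obtain ⟨k, o, ho, rfl⟩ := exists_eq_pos_add s t
  rcases lt_or_ge (o + 1) (blockLen (orbit s k)) with h | h
  · rw [Nat.add_assoc, mind_chain_pos_add hs (Nat.succ_pos o) h]
    refine iff_of_false (not_isInitial_chain_pos_add hs (Nat.succ_pos o) h) ?_
    rcases Nat.eq_zero_or_pos o with h0 | h0
    · rw [h0, Nat.add_zero (pos s k), mind_chain_pos hs]
      omega
    · rw [mind_chain_pos_add hs h0 ho]
      omega
  · have hb := two_le_blockLen (orbit s k)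
    have e : pos s k + o + 1 = pos s (k + 1) := by
      rw [pos_succ]
      omega
    rw [e, isInitial_chain_pos_succ hs, mind_chain_pos hs, mind_chain_pos_add hs (by omega) ho,
      orbit_succ, length_vec_next]
    split_ifs with hd <;> simp [hd]

theorem mind_chain_lt_succ_iff {s : List ℕ × List ℤ} (hs : Binary s) (t : ℕ) :
    mind (chain (cls (vec s)) t) < mind (chain (cls (vec s)) (t + 1)) ↔
      ∃ X, reduced (chain (cls (vec s)) t) = [0, 0] ++ X := by
  obtain ⟨k, o, ho, rfl⟩ := exists_eq_pos_add s t
  have hb := two_le_blockLen (orbit s k)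
  rcases Nat.eq_zero_or_pos o with rfl | h0
  · rw [Nat.add_zero, mind_chain_pos_add hs one_pos (by omega), mind_chain_pos hs,
      reduced_chain_pos hs]
    exact iff_of_true (by omega) ⟨_, rfl⟩
  · obtain ⟨Y, hY⟩ := reduced_chain_pos_add hs h0 ho
    rw [mind_chain_pos_add hs h0 ho, hY]
    refine iff_of_false ?_ (by simp)
    rcases lt_or_ge (o + 1) (blockLen (orbit s k)) with h | h
    · rw [Nat.add_assoc, mind_chain_pos_add hs (Nat.succ_pos o) h]
      omega
    · have e : pos s k + o + 1 = pos s (k + 1) := by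
        rw [pos_succ]
        omega
      rw [e, mind_chain_pos hs, orbit_succ, length_vec_next]
      split_ifs <;> omega

/-! ### Mind-profiles over runs of dropping and of non-dropping blocks. -/

/-- The part of length `n` of the mind-profile of a chain that starts at position `a`. -/
noncomputable def profile (γ : YoungDiagram) (a n : ℕ) : List ℕ :=
  (List.range' a n).map fun t => mind (chain γ t)

theorem profile_add (γ : YoungDiagram) (a m n : ℕ) :
    profile γ a (m + n) = profile γ a m ++ profile γ (a + m) n := by
  rw [profile, profile, profile, ← List.map_append, List.range'_append_1]

theorem profile_one (γ : YoungDiagram) (a : ℕ) : profile γ a 1 = [mind (chain γ a)] := rfl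

theorem profile_eq_replicate {γ : YoungDiagram} {a n m : ℕ}
    (h : ∀ o < n, mind (chain γ (a + o)) = m) : profile γ a n = List.replicate n m := by
  rw [List.eq_replicate_iff]
  refine ⟨by simp [profile], fun x hx => ?_⟩
  simp only [profile, List.mem_map, List.mem_range'_1] at hx
  obtain ⟨t, ht, rfl⟩ := hx
  rw [← h (t - a) (by omega), show a + (t - a) = t by omega]

theorem pos_add_of_drops {s : List ℕ × List ℤ} {k q : ℕ}
    (h : ∀ i < q, Drops (orbit s (k + i))) : pos s (k + q) = pos s k + 2 * q := by
  induction q with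
  | zero => rfl
  | succ q ih =>
    rw [← Nat.add_assoc, pos_succ, ih fun i hi => h i (by omega), blockLen,
      if_pos (h q (by omega))]
    omega

theorem length_vec_of_drops {s : List ℕ × List ℤ} {k q : ℕ}
    (h : ∀ i < q, Drops (orbit s (k + i))) :
    (vec (orbit s (k + q))).length = (vec (orbit s k)).length := by
  induction q with
  | zero => rfl
  | succ q ih =>
    rw [← Nat.add_assoc, orbit_succ, length_vec_next, if_pos (h q (by omega)),
      ih fun i hi => h i (by omega), Nat.add_zero]

theorem profile_of_drops {s : List ℕ × List ℤ} (hs : Binary s) {k q : ℕ}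
    (h : ∀ i < q, Drops (orbit s (k + i))) :
    profile (cls (vec s)) (pos s k) (2 * q + 1) = [(vec (orbit s k)).length] ++
      (List.replicate q [(vec (orbit s k)).length + 1, (vec (orbit s k)).length]).flatten := by
  induction q with
  | zero => simp [profile_one, mind_chain_pos hs]
  | succ q ih =>
    have hq : ∀ i < q, Drops (orbit s (k + i)) := fun i hi => h i (by omega)
    have hd := h q (by omega)
    rw [show 2 * (q + 1) + 1 = 2 * q + 1 + (1 + 1) by omega, profile_add, ih hq, profile_add,
      profile_one, profile_one, List.replicate_succ', List.flatten_concat, List.append_assoc]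
    have e1 : pos s k + (2 * q + 1) = pos s (k + q) + 1 := by
      rw [pos_add_of_drops hq]
      omega
    have e2 : pos s k + (2 * q + 1) + 1 = pos s (k + (q + 1)) := by
      rw [pos_add_of_drops h]
      omega
    rw [e2, mind_chain_pos hs, e1, mind_chain_pos_add hs (by omega) (by
      rw [blockLen, if_pos hd]; omega), length_vec_of_drops hq, length_vec_of_drops h]
    rfl

theorem length_vec_of_not_drops {s : List ℕ × List ℤ} {k q : ℕ}
    (h : ∀ i < q, ¬ Drops (orbit s (k + i))) :
    (vec (orbit s (k + q))).length = (vec (orbit s k)).length + q := by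
  induction q with
  | zero => rfl
  | succ q ih =>
    rw [← Nat.add_assoc, orbit_succ, length_vec_next, if_neg (h q (by omega)),
      ih fun i hi => h i (by omega), Nat.add_assoc]

theorem plateaus_succ (L k : ℕ) :
    plateaus L (k + 1) = plateaus L k ++ List.replicate (L + k) (L + k + 1) := by
  simp [plateaus, List.range_succ]

theorem profile_of_not_drops {s : List ℕ × List ℤ} (hs : Binary s) {k q : ℕ}
    (h : ∀ i < q, ¬ Drops (orbit s (k + i))) :
    profile (cls (vec s)) (pos s k) (pos s (k + q) - pos s k + 1) =
      plateaus (vec (orbit s k)).length q := by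
  induction q with
  | zero => simp [profile_one, mind_chain_pos hs, plateaus]
  | succ q ih =>
    have hq : ∀ i < q, ¬ Drops (orbit s (k + i)) := fun i hi => h i (by omega)
    have hd := h q (by omega)
    have hb := two_le_blockLen (orbit s (k + q))
    have hm : pos s k ≤ pos s (k + q) := (pos_strictMono s).monotone (by omega)
    have hL := length_vec_of_not_drops hq
    have hbL : blockLen (orbit s (k + q)) = (vec (orbit s k)).length + q := by
      rw [blockLen, if_neg hd, hL]
    rw [← Nat.add_assoc, pos_succ, plateaus_succ, ← ih hq,
      show pos s (k + q) + blockLen (orbit s (k + q)) - pos s k + 1 =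
        (pos s (k + q) - pos s k + 1) + ((vec (orbit s k)).length + q) by omega, profile_add]
    congr 1
    refine profile_eq_replicate fun o ho => ?_
    -- A plateau is offset by one from a block: its last entry belongs to the start of the next
    -- block, which has the same `mind` because the vector has grown by one.
    rcases lt_or_ge (1 + o) (blockLen (orbit s (k + q))) with h1 | h1
    · rw [show pos s k + (pos s (k + q) - pos s k + 1) + o = pos s (k + q) + (1 + o) by omega,
        mind_chain_pos_add hs (by omega) h1, hL]
    · rw [show pos s k + (pos s (k + q) - pos s k + 1) + o = pos s (k + q + 1) by
        rw [pos_succ]; omega, mind_chain_pos hs, Nat.add_assoc k, length_vec_of_not_drops h]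
      omega

theorem length_plateaus {s : List ℕ × List ℤ} (hs : Binary s) {k q : ℕ}
    (h : ∀ i < q, ¬ Drops (orbit s (k + i))) :
    (plateaus (vec (orbit s k)).length q).length = pos s (k + q) - pos s k + 1 := by
  rw [← profile_of_not_drops hs h]
  simp [profile]

theorem sum_vec_of_not_drops {s : List ℕ × List ℤ} {k q : ℕ}
    (h : ∀ i < q, ¬ Drops (orbit s (k + i))) :
    (vec (orbit s (k + q))).sum = (vec (orbit s k)).sum := by
  induction q with
  | zero => rfl
  | succ q ih =>
    rw [← Nat.add_assoc, orbit_succ, sum_vec_next, if_neg (h q (by omega)),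
      ih fun i hi => h i (by omega), sub_zero]

/-! ### Enumeration of the initial objects. -/

theorem isMark_iff {s : List ℕ × List ℤ} (hs : Binary s) {t : ℕ} :
    IsMark (vec s) t ↔ t = 0 ∨ ∃ k, Drops (orbit s k) ∧ t = pos s (k + 1) := by
  rcases Nat.eq_zero_or_pos t with rfl | ht
  · simp [IsMark]
  · simp only [IsMark, nuIter_eq_chain hs, Option.some.injEq, exists_eq_left',
      isInitial_chain_iff hs ht]

theorem finite_isMark {s : List ℕ × List ℤ} (hs : Binary s) : {t | IsMark (vec s) t}.Finite := by
  obtain ⟨K, hK⟩ := exists_forall_not_drops s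
  refine (Set.finite_le_nat (pos s K)).subset fun t ht => ?_
  have ht' : IsMark (vec s) t := ht
  rw [isMark_iff hs] at ht'
  show t ≤ pos s K
  rcases ht' with rfl | ⟨k, hk, rfl⟩
  · omega
  · refine (pos_strictMono s).monotone ?_
    by_contra! hc
    exact hK k (by omega) hk

theorem card_isMark {s : List ℕ × List ℤ} (hs : Binary s) :
    (finite_isMark hs).toFinset.card = numS (vec s) + 1 := by
  have e : {t | 0 < t ∧ IsMark (vec s) t} = {t | IsMark (vec s) t} \ {0} := by
    ext t
    simp [and_comm, Nat.pos_iff_ne_zero]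
  have h0 : 0 ∈ {t | IsMark (vec s) t} := .inl rfl
  rw [← Set.ncard_eq_toFinset_card _ (finite_isMark hs), numS, e,
    Set.ncard_sdiff_singleton_add_one h0 (finite_isMark hs)]

/-- The marked positions correspond to the starting state and the states entered by a drop. -/
theorem exists_marks {s : List ℕ × List ℤ} (hs : Binary s) : ∃ κ : ℕ → ℕ, κ 0 = 0 ∧
    (∀ j ≤ numS (vec s), posS (vec s) j = pos s (κ j)) ∧
    (∀ j < numS (vec s), ∃ m, κ (j + 1) = κ j + m + 1 ∧ Drops (orbit s (κ j + m)) ∧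
      ∀ i < m, ¬ Drops (orbit s (κ j + i))) ∧
    (∀ k, Drops (orbit s k) → ∃ j, 0 < j ∧ j ≤ numS (vec s) ∧ κ j = k + 1) := by
  set J := numS (vec s) with hJ
  have hcard := card_isMark hs
  have hfin := finite_isMark hs
  have hmem : ∀ j ≤ J, IsMark (vec s) (posS (vec s) j) := fun j hj =>
    Nat.nth_mem_of_lt_card hfin (by omega)
  have hlt : ∀ i j, i < j → j ≤ J → posS (vec s) i < posS (vec s) j := fun i j hij hj =>
    Nat.nth_lt_nth_of_lt_card hfin hij (by omega)
  have h0 : posS (vec s) 0 = 0 := Nat.nth_zero_of_zero (.inl rfl)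
  have hex : ∀ j, ∃ k, j ≤ J → posS (vec s) j = pos s k := by
    intro j
    by_cases hj : j ≤ J
    · rcases (isMark_iff hs).1 (hmem j hj) with h | ⟨k, -, h⟩
      · exact ⟨0, fun _ => h⟩
      · exact ⟨k + 1, fun _ => h⟩
    · exact ⟨0, fun h => (hj h).elim⟩
  choose κ hκ using hex
  have hinj := (pos_strictMono s).injective
  refine ⟨κ, hinj ?_, hκ, fun j hj => ?_, fun k hk => ?_⟩
  · rw [← hκ 0 (by omega), h0, pos_zero]
  · have h1 := hlt j (j + 1) (by omega) hj
    obtain ⟨k, hk, hk'⟩ : ∃ k, Drops (orbit s k) ∧ posS (vec s) (j + 1) = pos s (k + 1) := by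
      rcases (isMark_iff hs).1 (hmem (j + 1) hj) with h | h
      · omega
      · exact h
    have h2 : κ (j + 1) = k + 1 := hinj (by rw [← hκ (j + 1) hj, hk'])
    rw [hκ j (by omega), hκ (j + 1) hj, (pos_strictMono s).lt_iff_lt] at h1
    refine ⟨k - κ j, by omega, by rwa [show κ j + (k - κ j) = k by omega], fun i hi hd => ?_⟩
    -- An earlier drop would create a mark strictly between two consecutive marks.
    have h3 : IsMark (vec s) (pos s (κ j + i + 1)) := (isMark_iff hs).2 (.inr ⟨_, hd, rfl⟩)
    have h4 : pos s (κ j + i + 1) ≤ posS (vec s) j :=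
      Nat.le_nth_of_lt_nth_succ (by
        have h5 : pos s (κ j + i + 1) < pos s (k + 1) := pos_strictMono s (by omega)
        rwa [← hk'] at h5) h3
    rw [hκ j (by omega), (pos_strictMono s).le_iff_le] at h4
    omega
  · have h3 : IsMark (vec s) (pos s (k + 1)) := (isMark_iff hs).2 (.inr ⟨_, hk, rfl⟩)
    obtain ⟨j, hj, hj'⟩ := Nat.exists_lt_card_finite_nth_eq hfin h3
    have hj'' : posS (vec s) j = pos s (k + 1) := hj'
    have hjJ : j ≤ J := by omega
    refine ⟨j, Nat.pos_of_ne_zero ?_, hjJ, hinj (by rw [← hκ j hjJ, hj''])⟩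
    rintro rfl
    rw [h0, ← pos_zero s] at hj''
    have := hinj hj''
    omega

/-! ### Recognition of tail-initiators. -/

theorem exists_rowLens (ns : List ℕ) : ∃ w : List ℕ, w.SortedGE ∧
    (∀ x ∈ w, 0 < x ∧ x ≤ ns.length) ∧ ∀ i < ns.length, w.count (i + 1) = ns.getD i 0 := by
  induction ns using List.reverseRecOn with
  | nil => exact ⟨[], by simp [List.sortedGE_iff_pairwise], by simp, by simp⟩
  | append_singleton ns a ih =>
    obtain ⟨w, h1, h2, h3⟩ := ih
    refine ⟨List.replicate a (ns.length + 1) ++ w, ?_, ?_, ?_⟩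
    · rw [List.sortedGE_iff_pairwise, List.pairwise_append]
      refine ⟨List.pairwise_replicate.2 (.inr le_rfl), h1.pairwise, fun x hx y hy => ?_⟩
      have := (h2 y hy).2
      rw [List.eq_of_mem_replicate hx]
      omega
    · intro x hx
      simp only [List.mem_append, List.mem_replicate] at hx
      rw [List.length_append, List.length_singleton]
      rcases hx with ⟨-, rfl⟩ | hx
      · omega
      · have := h2 x hx
        omega
    · intro i hi
      rw [List.length_append, List.length_singleton] at hi
      rw [List.count_append, List.count_replicate]
      rcases Nat.lt_succ_iff_lt_or_eq.1 hi with h | rfl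
      · rw [h3 i h, if_neg (by simp; omega), List.getD_append _ _ _ _ h, Nat.zero_add]
      · rw [if_pos (by simp), List.count_eq_zero_of_not_mem fun h => by
          have := (h2 _ h).2
          omega, List.getD_append_right _ _ _ _ le_rfl]
        simp

/-- The multiplicities determine the partition. The last one must be nonzero for the largest part,
hence the number of groups, to come out right. -/
theorem exists_bWord_eq {ns : List ℕ} {a : ℕ} (ha : a ≠ 0) :
    ∃ μ, bWord μ = (ns ++ [a]).flatMap fun b => 0 :: List.replicate b 1 := by
  set N := ns ++ [a] with hN
  have hlen : N.length = ns.length + 1 := by simp [hN]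
  obtain ⟨w, h1, h2, h3⟩ := exists_rowLens N
  refine ⟨YoungDiagram.ofRowLens w h1, ?_⟩
  have hrow : (YoungDiagram.ofRowLens w h1).rowLen 0 = N.length := by
    have hmem : N.length ∈ w := by
      rw [← List.count_pos_iff, hlen, h3 _ (by omega), hN,
        List.getD_append_right _ _ _ _ le_rfl]
      simpa using Nat.pos_of_ne_zero ha
    rw [rowLen_ofRowLens_getD]
    rcases w with _ | ⟨x, w⟩
    · simp at hmem
    · rw [List.getD_cons_zero]
      refine le_antisymm (h2 x (by simp)).2 ?_
      rw [List.sortedGE_iff_pairwise, List.pairwise_cons] at h1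
      rcases List.mem_cons.1 hmem with h | h
      · exact h.le
      · exact h1.1 _ h
  have hself : (YoungDiagram.ofRowLens w h1).rowLens = w :=
    YoungDiagram.rowLens_ofRowLens_eq_self fun x hx => (h2 x hx).1
  rw [bWord, hrow, hself]
  have e : N = (List.range N.length).map fun i => N.getD i 0 := by
    refine List.ext_getElem (by simp) fun i hi _ => ?_
    rw [List.getElem_map, List.getElem_range, List.getD_eq_getElem]
  conv_rhs => rw [e, List.flatMap_map]
  refine List.flatMap_congr fun i hi => ?_
  rw [h3 i (List.mem_range.1 hi)]

theorem exists_flatMap_eq {Y : List ℤ} (hY : ∀ x ∈ Y, x = 0 ∨ x = 1) :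
    ∃ a ns, 0 :: Y = List.flatMap (fun b => 0 :: List.replicate b (1 : ℤ)) (a :: ns) := by
  induction Y with
  | nil => exact ⟨0, [], by simp⟩
  | cons x Y ih =>
    obtain ⟨a, ns, h⟩ := ih fun y hy => hY y (by simp [hy])
    rcases hY x (by simp) with rfl | rfl
    · exact ⟨0, a :: ns, by rw [h]; simp⟩
    · refine ⟨a + 1, ns, ?_⟩
      rw [List.flatMap_cons, List.cons_append, List.cons.injEq] at h
      rw [h.2]
      simp [List.replicate_succ]

theorem exists_tailInit_eq {X : List ℤ} (hX : ∀ x ∈ X, x = 0 ∨ x = 1) :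
    ∃ μ, cls ([0, 0] ++ X ++ [1]) = tailInit μ := by
  obtain ⟨a, ns, h⟩ := exists_flatMap_eq (Y := X ++ [1]) (fun x hx => by
    rw [List.mem_append, List.mem_singleton] at hx
    exact hx.elim (hX x) .inr)
  obtain ⟨ms, b, hb⟩ : ∃ ms b, a :: ns = ms ++ [b] :=
    ⟨_, _, (List.dropLast_append_getLast (List.cons_ne_nil a ns)).symm⟩
  rw [hb] at h
  have hb0 : b ≠ 0 := by
    rintro rfl
    have := congrArg List.getLast? h
    rw [List.flatMap_append, ← List.cons_append, List.getLast?_concat] at this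
    simp at this
  obtain ⟨μ, hμ⟩ := exists_bWord_eq (ns := ms) hb0
  exact ⟨μ, by rw [tailInit, hμ, ← h]; simp⟩

/-! ### The explicit orbit of the given vector. -/

/-- The state of the vector `vecW n r C i c`. -/
def stateW (n : ℕ → ℕ) (r : ℕ) (C : List ℤ) (i c : ℕ) : List ℕ × List ℤ :=
  ((n i - 2 * c) :: (List.range' (i + 1) (r - i)).map n,
    List.replicate (numEven n i) 1 ++ C ++ trail n i ++ List.replicate (2 * c) 1)

/-- The index `k` such that `vecV n r C i` is the `k`-th vector of the form `vec s`, for `i ≤ r`. -/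
def blockIdx (n : ℕ → ℕ) (i : ℕ) : ℕ :=
  ∑ k ∈ Finset.range i, (n k / 2 + 1)

/-- The index `k` such that `vecV n r C i` is the `k`-th vector of the form `vec s`. -/
def idxV (n : ℕ → ℕ) (r i : ℕ) : ℕ :=
  if i ≤ r then blockIdx n i else blockIdx n r + (n r + 1) / 2

theorem word_map_range' (n : ℕ → ℕ) (i r : ℕ) :
    word ((List.range' i (r + 1 - i)).map n) = twos n i r := by
  rw [word, twos, List.flatMap_map]

theorem vec_stateW (n : ℕ → ℕ) (r : ℕ) (C : List ℤ) (i c : ℕ) :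
    vec (stateW n r C i c) = vecW n r C i c := by
  have := word_map_range' n (i + 1) r
  rw [show r + 1 - (i + 1) = r - i by omega] at this
  simp [vec, stateW, vecW, this]

theorem vecV_eq_vecW {n : ℕ → ℕ} {r i : ℕ} (hi : i ≤ r) (C : List ℤ) :
    vecV n r C i = vecW n r C i 0 := by
  rw [vecV, if_pos hi, vecW, twos, show r + 1 - i = r - i + 1 by omega, List.range'_succ, twos,
    show r + 1 - (i + 1) = r - i by omega]
  simp

theorem mem_trail {n : ℕ → ℕ} {i : ℕ} : ∀ x ∈ trail n i, x = 0 ∨ x = 1 := by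
  intro x hx
  simp only [trail, List.mem_flatMap, List.mem_append, List.mem_replicate,
    List.mem_singleton] at hx
  obtain ⟨k, -, (⟨-, h⟩ | h) | ⟨-, h⟩⟩ := hx <;> simp [h]

theorem binary_stateW {n : ℕ → ℕ} {r : ℕ} {C : List ℤ} (hC : ∀ x ∈ C, x = 0 ∨ x = 1) (i c : ℕ) :
    Binary (stateW n r C i c) := by
  intro x hx
  simp only [stateW, List.mem_append, List.mem_replicate] at hx
  rcases hx with ((⟨-, h⟩ | h) | h) | ⟨-, h⟩
  · exact .inr h
  · exact hC x h
  · exact mem_trail x h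
  · exact .inr h

theorem numEven_succ (n : ℕ → ℕ) (i : ℕ) :
    numEven n (i + 1) = numEven n i + if n i % 2 = 0 then 1 else 0 := by
  simp [numEven, List.range_succ, List.countP_append, List.countP_singleton]

theorem trail_succ (n : ℕ → ℕ) (i : ℕ) :
    trail n (i + 1) = trail n i ++
      (List.replicate (2 * (n i / 2)) 1 ++ [0] ++ List.replicate (n i % 2) 1) := by
  simp [trail, List.range_succ]

theorem next_stateW {n : ℕ → ℕ} {r i c : ℕ} (C : List ℤ) (hc : 2 * (c + 1) ≤ n i) :
    next (stateW n r C i c) = stateW n r C i (c + 1) := by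
  simp only [stateW]
  rw [show n i - 2 * c = n i - 2 * (c + 1) + 2 by omega, next,
    show 2 * (c + 1) = 2 * c + 2 by ring, List.replicate_add]
  simp

/-- The removal of what is left of group `i` is where parity enters: if `n i` is even, the leftover
`1` moves in front of `C` (raising `p_i`) and 0 is appended; if odd, the leftover `12` goes and `01`
is appended. -/
theorem next_stateW_half {n : ℕ → ℕ} {r i : ℕ} (C : List ℤ) (hi : i < r) :
    next (stateW n r C i (n i / 2)) = stateW n r C (i + 1) 0 := by
  simp only [stateW]
  rw [show r - i = r - (i + 1) + 1 by omega, List.range'_succ, numEven_succ, trail_succ]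
  rcases Nat.mod_two_eq_zero_or_one (n i) with h | h
  · rw [show n i - 2 * (n i / 2) = 0 by omega, next, if_pos h, h]
    simp [List.replicate_succ]
  · rw [show n i - 2 * (n i / 2) = 1 by omega, next, if_neg (by omega), h]
    simp

theorem blockIdx_succ (n : ℕ → ℕ) (i : ℕ) : blockIdx n (i + 1) = blockIdx n i + n i / 2 + 1 := by
  rw [blockIdx, Finset.sum_range_succ, ← Nat.add_assoc]
  rfl

theorem orbit_add_of_orbit {n : ℕ → ℕ} {r i k : ℕ} {C : List ℤ} {s : List ℕ × List ℤ}
    (h : orbit s k = stateW n r C i 0) {c : ℕ} (hc : 2 * c ≤ n i) :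
    orbit s (k + c) = stateW n r C i c := by
  induction c with
  | zero => exact h
  | succ c ih => rw [← Nat.add_assoc, orbit_succ, ih (by omega), next_stateW C hc]

theorem orbit_blockIdx {n : ℕ → ℕ} {r i : ℕ} (C : List ℤ) (hi : i ≤ r) :
    orbit (stateW n r C 0 0) (blockIdx n i) = stateW n r C i 0 := by
  induction i with
  | zero => rfl
  | succ i ih =>
    rw [blockIdx_succ, orbit_succ, orbit_add_of_orbit (ih (by omega)) (by omega),
      next_stateW_half C (by omega)]

theorem orbit_blockIdx_add {n : ℕ → ℕ} {r i c : ℕ} (C : List ℤ) (hi : i ≤ r) (hc : 2 * c ≤ n i) :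
    orbit (stateW n r C 0 0) (blockIdx n i + c) = stateW n r C i c :=
  orbit_add_of_orbit (orbit_blockIdx C hi) hc

theorem drops_blockIdx_add {n : ℕ → ℕ} {r i c : ℕ} (C : List ℤ) (hi : i ≤ r) (hc : 2 * c ≤ n i) :
    Drops (orbit (stateW n r C 0 0) (blockIdx n i + c)) ↔ 2 * c < n i := by
  rw [orbit_blockIdx_add C hi hc]
  simp [Drops, stateW]
  omega

/-- Group `i` causes `⌈n_i / 2⌉` drops. If `n_i` is even, a non-dropping block removes the empty
group, except for `i = r`, where `v^{(r+1)}` is taken right after the last drop. -/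
theorem idxV_succ {n : ℕ → ℕ} {r i : ℕ} (hi : i ≤ r) :
    idxV n r (i + 1) = blockIdx n i + (n i + 1) / 2 + if Even (n i) ∧ i < r then 1 else 0 := by
  rcases Nat.lt_or_eq_of_le hi with h | rfl
  · rw [idxV, if_pos (by omega), blockIdx_succ]
    rcases Nat.even_or_odd (n i) with he | ho
    · rw [if_pos ⟨he, h⟩]
      rw [Nat.even_iff] at he
      omega
    · rw [if_neg (fun hc => Nat.not_even_iff_odd.2 ho hc.1)]
      rw [Nat.odd_iff] at ho
      omega
  · simp [idxV]

theorem vec_orbit_idxV {n : ℕ → ℕ} {r i : ℕ} (C : List ℤ) (hi : i ≤ r + 1) :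
    vec (orbit (stateW n r C 0 0) (idxV n r i)) = vecV n r C i := by
  rcases Nat.lt_or_eq_of_le hi with h | rfl
  · rw [idxV, if_pos (by omega), orbit_blockIdx C (by omega), vec_stateW,
      vecV_eq_vecW (by omega)]
  · rw [idxV, if_neg (by omega), vecV, if_neg (by omega), numEven_succ]
    rcases Nat.mod_two_eq_zero_or_one (n r) with h | h
    -- The `1` of the emptied last group is still present and is the extra `1` counted by `p_{r+1}`.
    · rw [show (n r + 1) / 2 = n r / 2 by omega, orbit_blockIdx_add C le_rfl (by omega), if_pos h, h]
      simp [vec, stateW, List.replicate_succ, show n r - 2 * (n r / 2) = 0 by omega]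
    · rw [show (n r + 1) / 2 = n r / 2 + 1 by omega, ← Nat.add_assoc, orbit_succ,
        orbit_blockIdx_add C le_rfl (by omega), if_neg (by omega), h, stateW,
        show n r - 2 * (n r / 2) = 1 by omega, next]
      simp [vec]

theorem not_drops_of_idxV_le {n : ℕ → ℕ} {r : ℕ} {C : List ℤ} (hC : ∀ x ∈ C, x = 0 ∨ x = 1)
    {k : ℕ} (hk : idxV n r (r + 1) ≤ k) : ¬ Drops (orbit (stateW n r C 0 0) k) := by
  have hs : Binary (stateW n r C 0 0) := binary_stateW hC 0 0
  intro hd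
  have h2 := (two_mem_vec_orbit_iff hs _).2 ⟨k, hk, hd⟩
  rw [vec_orbit_idxV C le_rfl, vecV, if_neg (by omega)] at h2
  have h3 : ¬ (2 : ℤ) ∈ C := fun h => by
    have := hC _ h
    omega
  have h4 : ¬ (2 : ℤ) ∈ trail n r := fun h => by
    have := mem_trail _ h
    omega
  simp [h3, h4] at h2

theorem exists_eq_blockIdx_add {n : ℕ → ℕ} {R k : ℕ} (hk : k < blockIdx n R) :
    ∃ i < R, ∃ c ≤ n i / 2, k = blockIdx n i + c := by
  induction R with
  | zero => simp [blockIdx] at hk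
  | succ R ih =>
    rcases lt_or_ge k (blockIdx n R) with h | h
    · obtain ⟨i, hi, c, hc, rfl⟩ := ih h
      exact ⟨i, by omega, c, hc, rfl⟩
    · rw [blockIdx_succ] at hk
      exact ⟨R, by omega, k - blockIdx n R, by omega, by omega⟩

theorem exists_of_drops {n : ℕ → ℕ} {r : ℕ} {C : List ℤ} (hC : ∀ x ∈ C, x = 0 ∨ x = 1)
    {k : ℕ} (hk : Drops (orbit (stateW n r C 0 0) k)) :
    ∃ i ≤ r, ∃ c, 2 * c < n i ∧ k = blockIdx n i + c := by
  have h1 : k < blockIdx n (r + 1) := by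
    by_contra! hc
    refine not_drops_of_idxV_le hC ?_ hk
    rw [blockIdx_succ] at hc
    rw [idxV, if_neg (by omega)]
    omega
  obtain ⟨i, hi, c, hc, rfl⟩ := exists_eq_blockIdx_add h1
  exact ⟨i, by omega, c, (drops_blockIdx_add C (by omega) (by omega)).1 hk, rfl⟩

/-- After `00`, being initial means that the last entry is positive. For empty `C` that entry is a
2, because `n r > 0`. -/
theorem isInitial_vec_iff {n : ℕ → ℕ} {r : ℕ} (hr : 0 < n r) {C : List ℤ}
    (hC : ∀ x ∈ C, x = 0 ∨ x = 1) {v : List ℤ} (hv : v = [0, 0] ++ twos n 0 r ++ C)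
    (hd : IsDyck v) : IsInitial (cls v) ↔ C = [] ∨ C.getLast? = some 1 := by
  rcases List.eq_nil_or_concat' C with rfl | ⟨E, x, rfl⟩
  · obtain ⟨a, ha⟩ : ∃ a, n r = a + 1 := ⟨n r - 1, by omega⟩
    obtain ⟨Y, e⟩ : ∃ Y, v = 0 :: 0 :: (Y ++ [2]) := by
      refine ⟨((List.range' 0 r).flatMap fun k => 1 :: List.replicate (n k) 2) ++
        1 :: List.replicate a 2, ?_⟩
      rw [hv, twos, Nat.sub_zero, List.range'_concat, List.flatMap_append]
      simp [ha, List.replicate_succ']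
    rw [e] at hd ⊢
    exact iff_of_true (isInitial_cls hd.1 (by omega)) (.inl rfl)
  · have e : v = 0 :: 0 :: ((twos n 0 r ++ E) ++ [x]) := by simp [hv]
    rw [e] at hd ⊢
    rcases hC x (by simp) with rfl | rfl
    · refine iff_of_false ?_ (by simp)
      have := not_isInitial_cls (m := 1) (Z := 0 :: (twos n 0 r ++ E)) (x := 0)
        (by rw [ramp_one]; exact hd.1) (by norm_num)
      rwa [ramp_one] at this
    · exact iff_of_true (isInitial_cls hd.1 le_rfl) (by simp)

theorem profile_idxV {n : ℕ → ℕ} {r : ℕ} {C : List ℤ} (hC : ∀ x ∈ C, x = 0 ∨ x = 1)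
    {i : ℕ} (hi : i ≤ r) {L : ℕ} (hL : L = (vecV n r C i).length) :
    profile (cls (vec (stateW n r C 0 0))) (pos (stateW n r C 0 0) (idxV n r i))
      (pos (stateW n r C 0 0) (idxV n r (i + 1)) + 1 - pos (stateW n r C 0 0) (idxV n r i)) =
      [L] ++ (List.replicate ((n i + 1) / 2) [L + 1, L]).flatten ++
        (if Even (n i) ∧ i < r then List.replicate L (L + 1) else []) := by
  have hs : Binary (stateW n r C 0 0) := binary_stateW hC 0 0
  set s := stateW n r C 0 0
  have hdr : ∀ c < (n i + 1) / 2, Drops (orbit s (blockIdx n i + c)) := fun c hc =>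
    (drops_blockIdx_add C hi (by omega)).2 (by omega)
  have hidx : idxV n r i = blockIdx n i := if_pos hi
  have hL' : (vec (orbit s (blockIdx n i))).length = L := by
    rw [hL, ← hidx, vec_orbit_idxV C (by omega)]
  have h1 := profile_of_drops hs hdr
  have h2 := pos_add_of_drops hdr
  have h3 := length_vec_of_drops hdr
  rw [hL'] at h1 h3
  rw [idxV_succ hi, hidx]
  split_ifs with hc
  · have hnd : ∀ j < 1, ¬ Drops (orbit s (blockIdx n i + (n i + 1) / 2 + j)) := by
      intro j hj
      have he := Nat.even_iff.1 hc.1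
      rw [show j = 0 by omega, Nat.add_zero, drops_blockIdx_add C hi (by omega)]
      omega
    have h4 := profile_of_not_drops hs hnd
    have h5 : blockLen (orbit s (blockIdx n i + (n i + 1) / 2)) = L := by
      rw [blockLen, if_neg (by simpa using hnd 0 one_pos), h3]
    rw [h3, pos_succ, h5, show pos s (blockIdx n i + (n i + 1) / 2) + L -
      pos s (blockIdx n i + (n i + 1) / 2) + 1 = 1 + L by omega, profile_add, profile_one,
      mind_chain_pos hs, h3, h2] at h4
    rw [pos_succ, h5, h2, show pos s (blockIdx n i) + 2 * ((n i + 1) / 2) + L + 1 -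
      pos s (blockIdx n i) = 2 * ((n i + 1) / 2) + 1 + L by omega, profile_add, h1]
    congr 1
    rw [← Nat.add_assoc]
    simpa [plateaus] using h4
  · rw [Nat.add_zero (blockIdx n i + _), h2, show pos s (blockIdx n i) + 2 * ((n i + 1) / 2) + 1 -
      pos s (blockIdx n i) = 2 * ((n i + 1) / 2) + 1 by omega, h1, List.append_nil]

end DyckChain

/-! ### Assembly of the theorem from the block structure. -/

theorem mainTheorem6 (r : ℕ) (n : ℕ → ℕ) (hr : 0 < n r) (C : List ℤ)
    (hC : ∀ x ∈ C, x = 0 ∨ x = 1) (v : List ℤ) (hv : v = [0, 0] ++ twos n 0 r ++ C) :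
    IsDyck v ∧
    -- `c t = NU^t([v])` is defined for all `t`; `τ i` is the position of `[v^{(i)}]` in the chain
    ∃ (c : ℕ → YoungDiagram) (τ : ℕ → ℕ) (J : ℕ),
      (∀ t, nuIter (cls v) t = some (c t)) ∧
      {t | 0 < t ∧ IsMark v t}.Finite ∧ J = numS v ∧
      -- (a)
      vecV n r C 0 = v ∧ τ 0 = 0 ∧
      (∀ i ≤ r, τ i < τ (i + 1)) ∧
      (∀ i ≤ r + 1, IsDyck (vecV n r C i) ∧ c (τ i) = cls (vecV n r C i)) ∧
      (∃ μ : YoungDiagram, cls (vecV n r C (r + 1)) = tailInit μ) ∧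
      -- (b)
      (∀ i ≤ r + 1, mind (cls (vecV n r C i)) = (vecV n r C i).length) ∧
      (∀ i ≤ r, ∀ L, L = (vecV n r C i).length →
        (List.range' (τ i) (τ (i + 1) + 1 - τ i)).map (fun t => mind (c t)) =
          [L] ++ (List.replicate ((n i + 1) / 2) [L + 1, L]).flatten ++
            (if Even (n i) ∧ i < r then List.replicate L (L + 1) else [])) ∧
      (∀ L, L = (vecV n r C (r + 1)).length → ∀ k,
        (List.range' (τ (r + 1)) (plateaus L k).length).map (fun t => mind (c t)) =
          plateaus L k) ∧
      -- (c)
      (∀ t, IsInitial (c (t + 1)) ↔ mind (c (t + 1)) < mind (c t)) ∧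
      -- (d)
      {u | ∃ t, IsInitial (c t) ∧ u = reduced (c t)} =
        {u | ∃ j ≤ J, IsInitial (cls (vecS v j)) ∧ u = vecS v j} ∧
      {u | ∃ j ≤ J, IsInitial (cls (vecS v j)) ∧ u = vecS v j} =
        {u | ((C = [] ∨ C.getLast? = some 1) ∧ u = v) ∨
          (∃ i, 0 < i ∧ i ≤ r + 1 ∧ Odd (n (i - 1)) ∧ u = vecV n r C i) ∨
          (∃ i ≤ r, ∃ k, 0 < 2 * k ∧ 2 * k ≤ n i ∧ u = vecW n r C i k)} ∧
      vecS v J = vecV n r C (r + 1) ∧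
      -- (e)
      (∀ j ≤ J, (2 ∈ vecS v j ↔ j ≠ J)) ∧
      (∀ j ≤ J, IsReducedVec (vecS v j) ∧ mind (cls (vecS v j)) = (vecS v j).length ∧
        c (posS v j) = cls (vecS v j)) ∧
      (∀ j, 0 < j → j ≤ J → IsForm (vecS v j)) ∧
      (∀ t, 0 < t → t ≤ posS v J → IsForm (reduced (c t)) →
        ∃ j, 0 < j ∧ j ≤ J ∧ reduced (c t) = vecS v j) ∧
      (∀ t, mind (c t) < mind (c (t + 1)) ↔ ∃ X, reduced (c t) = [0, 0] ++ X) ∧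
      -- (f)
      (∀ j < J, ∃ k,
        (List.range' (posS v j) (posS v (j + 1) - posS v j)).map (fun t => mind (c t)) <+:
          plateaus (vecS v j).length k) ∧
      (∀ j ≤ J, mind (c (posS v j + 1)) = (vecS v j).length + 1) ∧
      (∀ j, 0 < j → j ≤ J → mind (c (posS v j - 1)) = (vecS v j).length + 1) ∧
      (∀ j < J, (vecS v j).length ≤ (vecS v (j + 1)).length) ∧
      -- (g)
      (∀ j < J, (vecS v (j + 1)).sum = (vecS v j).sum - 2) := by
  have hv0 : vec (stateW n r C 0 0) = v := by
    rw [vec_stateW, ← vecV_eq_vecW (Nat.zero_le r), vecV, if_pos (Nat.zero_le r), hv]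
    simp [numEven, trail]
  have hs : Binary (stateW n r C 0 0) := binary_stateW hC 0 0
  have hD : ∀ {i c}, i ≤ r → 2 * c ≤ n i →
      (Drops (orbit (stateW n r C 0 0) (blockIdx n i + c)) ↔ 2 * c < n i) :=
    fun hi hc => drops_blockIdx_add C hi hc
  have hW : ∀ {i c}, i ≤ r → 2 * c ≤ n i →
      vec (orbit (stateW n r C 0 0) (blockIdx n i + c)) = vecW n r C i c := fun hi hc => by
    rw [orbit_blockIdx_add C hi hc, vec_stateW]
  have hV : ∀ {i}, i ≤ r + 1 → vec (orbit (stateW n r C 0 0) (idxV n r i)) = vecV n r C i :=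
    fun hi => vec_orbit_idxV C hi
  have hend : ∀ {k}, idxV n r (r + 1) ≤ k → ¬ Drops (orbit (stateW n r C 0 0) k) :=
    fun hk => not_drops_of_idxV_le hC hk
  have hex : ∀ {k}, Drops (orbit (stateW n r C 0 0) k) →
      ∃ i ≤ r, ∃ c, 2 * c < n i ∧ k = blockIdx n i + c := fun hk => exists_of_drops hC hk
  have hprof := fun i (hi : i ≤ r) L (hL : L = (vecV n r C i).length) =>
    profile_idxV (n := n) hC hi hL
  have hdv : IsDyck v := hv0 ▸ isDyck_vec hs
  have hinit := isInitial_vec_iff hr hC hv hdv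
  obtain ⟨κ, hκ0, hκ, hκs, hκd⟩ := exists_marks hs
  have hfin := finite_isMark hs
  clear hv
  -- What is needed about the concrete state has been recorded in the facts above, so the state can
  -- be made opaque.
  generalize stateW n r C 0 0 = s at *
  subst hv0
  set J := numS (vec s) with hJ
  have hlast : 0 < idxV n r (r + 1) ∧ Drops (orbit s (idxV n r (r + 1) - 1)) := by
    have e : idxV n r (r + 1) - 1 = blockIdx n r + ((n r + 1) / 2 - 1) := by
      rw [idxV, if_neg (by omega)]
      omega
    refine ⟨?_, ?_⟩
    · rw [idxV, if_neg (by omega)]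
      omega
    · rw [e]
      exact (hD le_rfl (by omega)).2 (by omega)
  have hκJ : κ J = idxV n r (r + 1) := by
    -- The target of the last drop is marked, and any further mark would require a later drop.
    obtain ⟨j, -, hj, hj'⟩ := hκd _ hlast.2
    rw [Nat.sub_add_cancel hlast.1] at hj'
    rcases Nat.lt_or_eq_of_le hj with h | rfl
    · obtain ⟨m, -, hm, -⟩ := hκs j h
      exact (hend (by omega) hm).elim
    · exact hj'
  have hpred : ∀ j, 0 < j → j ≤ J → ∃ k, κ j = k + 1 ∧ Drops (orbit s k) := by
    intro j hj hjJ
    obtain ⟨m, hm, hm', -⟩ := hκs (j - 1) (by omega)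
    rw [Nat.sub_add_cancel hj] at hm
    exact ⟨_, hm, hm'⟩
  have hS : ∀ j ≤ J, vecS (vec s) j = vec (orbit s (κ j)) := by
    intro j hj
    rcases Nat.eq_zero_or_pos j with rfl | h0
    · rw [vecS, if_pos rfl, hκ0]
      rfl
    · rw [vecS, if_neg (by omega), hκ j hj, nuIter_pos hs, Option.map_some, Option.getD_some,
        reduced_vec (hs.orbit _)]
  have hSD : ∀ i, i ≤ r + 1 → IsDyck (vecV n r C i) := fun i hi =>
    hV hi ▸ isDyck_vec (hs.orbit _)
  refine ⟨hdv, chain (cls (vec s)), fun i => pos s (idxV n r i), J, nuIter_eq_chain hs,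
    hfin.subset fun t ht => ht.2, rfl, ?_, ?_, ?_, ?_, ?_, ?_, hprof, ?_,
    isInitial_chain_succ_iff hs, ?_, ?_, ?_, ?_, ?_, ?_, ?_, mind_chain_lt_succ_iff hs,
    ?_, ?_, ?_, ?_, ?_⟩
  · rw [← hV (Nat.zero_le _)]
    rfl
  · rfl
  · intro i hi
    refine pos_strictMono s ?_
    rw [idxV_succ hi, idxV, if_pos hi]
    rcases Nat.lt_or_eq_of_le hi with h | rfl
    · rcases Nat.even_or_odd (n i) with he | ho
      · rw [if_pos ⟨he, h⟩]
        omega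
      · have := ho.pos
        omega
    · omega
  · exact fun i hi => ⟨hSD i hi, by rw [chain_pos hs, hV hi]⟩
  -- A drop leads to `v^{(r+1)}`, hence the shape `00X1`; no drop follows, hence no 2. A binary `X`
  -- then gives a tail-initiator.
  · have hform := (isForm_vec_next (hs.orbit (idxV n r (r + 1) - 1))).2 hlast.2
    rw [← orbit_succ, Nat.sub_add_cancel hlast.1] at hform
    have h2 : 2 ∉ vec (orbit s (idxV n r (r + 1))) := fun h => by
      obtain ⟨m, hm, hd⟩ := (two_mem_vec_orbit_iff hs _).1 h
      exact hend hm hd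
    obtain ⟨X, hX, e⟩ := hform
    rw [← hV le_rfl, e]
    refine exists_tailInit_eq fun x hx => ?_
    rcases hX x hx with h | h | h
    · exact .inl h
    · exact .inr h
    · rw [e, ← h] at h2
      simp [hx] at h2
  · intro i hi
    rw [← hV hi, mind_vec (hs.orbit _)]
  · rintro L rfl k
    have hnd : ∀ i < k, ¬ Drops (orbit s (idxV n r (r + 1) + i)) := fun i _ => hend (by omega)
    rw [← hV le_rfl, length_plateaus hs hnd]
    exact profile_of_not_drops hs hnd
  · ext u
    constructor
    · rintro ⟨t, ht, rfl⟩
      rcases Nat.eq_zero_or_pos t with rfl | h0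
      · refine ⟨0, Nat.zero_le _, ?_, ?_⟩
        · rw [vecS, if_pos rfl]
          exact ht
        · rw [vecS, if_pos rfl]
          exact reduced_vec hs
      · obtain ⟨k, hk, rfl⟩ := (isInitial_chain_iff hs h0).1 ht
        obtain ⟨j, -, hj, hj'⟩ := hκd k hk
        refine ⟨j, hj, ?_, ?_⟩
        · rwa [hS j hj, hj', ← chain_pos hs]
        · rw [hS j hj, hj', reduced_chain_pos hs]
    · rintro ⟨j, hj, hi, rfl⟩
      rw [hS j hj, ← chain_pos hs] at hi
      exact ⟨_, hi, by rw [hS j hj, reduced_chain_pos hs]⟩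
  · have hdrop : ∀ k, Drops (orbit s k) →
        ∃ j ≤ J, IsInitial (cls (vecS (vec s) j)) ∧ vec (orbit s (k + 1)) = vecS (vec s) j := by
      intro k hk
      obtain ⟨j, -, hj, hj'⟩ := hκd k hk
      refine ⟨j, hj, ?_, by rw [hS j hj, hj']⟩
      rw [hS j hj, hj', ← chain_pos hs]
      exact (isInitial_chain_pos_succ hs k).2 hk
    have hodd : ∀ i ≤ r, ∀ c, n i = 2 * c + 1 →
        idxV n r (i + 1) = blockIdx n i + c + 1 := by
      intro i hi c hc
      rw [idxV_succ hi, if_neg (fun h => by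
        have := Nat.even_iff.1 h.1
        omega)]
      omega
    ext u
    constructor
    · rintro ⟨j, hj, hi, rfl⟩
      rcases Nat.eq_zero_or_pos j with rfl | h0
      · refine .inl ⟨hinit.1 ?_, ?_⟩
        · rwa [vecS, if_pos rfl] at hi
        · rw [vecS, if_pos rfl]
      · obtain ⟨k, hk, hd⟩ := hpred j h0 hj
        obtain ⟨i, hi, c, hc, rfl⟩ := hex hd
        rw [hS j hj, hk]
        -- A drop with at least two 2's left in the group leads to the vector with `c + 1`; with a
        -- single 2 left, `n i` is odd and the drop leads to `v^{(i+1)}`.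
        rcases Nat.lt_or_ge (2 * c + 1) (n i) with h | h
        · refine .inr (.inr ⟨i, hi, c + 1, by omega, by omega, ?_⟩)
          rw [Nat.add_assoc, hW hi (by omega)]
        · refine .inr (.inl ⟨i + 1, by omega, by omega, ?_, ?_⟩)
          · rw [Nat.add_sub_cancel, Nat.odd_iff]
            omega
          · rw [← hodd i hi c (by omega), hV (by omega)]
    · rintro (⟨hc, rfl⟩ | ⟨i, hi0, hi, hodd', rfl⟩ | ⟨i, hi, c, hc0, hc, rfl⟩)
      · refine ⟨0, Nat.zero_le _, ?_, ?_⟩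
        · rw [vecS, if_pos rfl]
          exact hinit.2 hc
        · rw [vecS, if_pos rfl]
      · obtain ⟨i, rfl⟩ : ∃ k, i = k + 1 := ⟨i - 1, by omega⟩
        obtain ⟨c, hc⟩ := hodd'
        rw [Nat.add_sub_cancel] at hc
        have := hdrop (blockIdx n i + c) ((hD (by omega) (by omega)).2 (by omega))
        rwa [← hodd i (by omega) c hc, hV hi] at this
      · obtain ⟨c, rfl⟩ : ∃ k, c = k + 1 := ⟨c - 1, by omega⟩
        have := hdrop (blockIdx n i + c) ((hD hi (by omega)).2 (by omega))
        rwa [Nat.add_assoc, hW hi hc] at this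
  · rw [hS J le_rfl, hκJ, hV le_rfl]
  · intro j hj
    rw [hS j hj, two_mem_vec_orbit_iff hs]
    constructor
    · rintro ⟨m, hm, hd⟩ rfl
      exact hend (by omega) hd
    · intro h
      obtain ⟨m, -, hm, -⟩ := hκs j (by omega)
      exact ⟨_, by omega, hm⟩
  · intro j hj
    rw [hS j hj, hκ j hj]
    exact ⟨⟨isDyck_vec (hs.orbit _), reduced_vec (hs.orbit _)⟩, mind_vec (hs.orbit _),
      chain_pos hs _⟩
  · intro j h0 hj
    obtain ⟨k, hk, hd⟩ := hpred j h0 hj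
    rw [hS j hj, hk, orbit_succ, isForm_vec_next (hs.orbit k)]
    exact hd
  · intro t ht _ hf
    obtain ⟨k, o, ho, rfl⟩ := exists_eq_pos_add s t
    rcases Nat.eq_zero_or_pos o with rfl | h0
    · cases k with
      | zero => simp [pos_zero] at ht
      | succ k =>
        rw [Nat.add_zero, reduced_chain_pos hs, orbit_succ, isForm_vec_next (hs.orbit k)] at hf
        obtain ⟨j, hj0, hj, hj'⟩ := hκd k hf
        exact ⟨j, hj0, hj, by rw [Nat.add_zero, reduced_chain_pos hs, hS j hj, hj']⟩
    · obtain ⟨Y, hY⟩ := reduced_chain_pos_add hs h0 ho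
      obtain ⟨X, -, hX⟩ := hf
      rw [hY] at hX
      simp at hX
  · intro j hj
    obtain ⟨m, hm, hd, hnd⟩ := hκs j hj
    -- Between two marks there are `m` non-dropping blocks, which fill `m` plateaus, and then one
    -- dropping block, whose middle object starts the next plateau.
    refine ⟨m + 1, ?_⟩
    have h1 := profile_of_not_drops hs hnd
    have h2 := length_vec_of_not_drops hnd
    have h3 : pos s (κ j) ≤ pos s (κ j + m) := (pos_strictMono s).monotone (by omega)
    have hb : blockLen (orbit s (κ j + m)) = 2 := if_pos hd
    rw [hκ j hj.le, hκ (j + 1) hj, hm, hS j hj.le, pos_succ, hb, plateaus_succ, ← h1,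
      show pos s (κ j + m) + 2 - pos s (κ j) = pos s (κ j + m) - pos s (κ j) + 1 + 1 by omega]
    change profile (cls (vec s)) _ _ <+: _
    rw [profile_add, List.prefix_append_right_inj, profile_one,
      show pos s (κ j) + (pos s (κ j + m) - pos s (κ j) + 1) = pos s (κ j + m) + 1 by omega,
      mind_chain_pos_add hs one_pos (by omega), h2]
    obtain ⟨d, hd'⟩ : ∃ d, (vec (orbit s (κ j))).length + m = d + 1 :=
      ⟨_, (Nat.sub_add_cancel (by rw [length_vec]; omega)).symm⟩
    rw [hd', List.replicate_succ]
    simp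
  · intro j hj
    have hb := two_le_blockLen (orbit s (κ j))
    rw [hκ j hj, hS j hj, mind_chain_pos_add hs one_pos (by omega)]
  · intro j h0 hj
    obtain ⟨k, hk, hd⟩ := hpred j h0 hj
    have hb : blockLen (orbit s k) = 2 := if_pos hd
    rw [hκ j hj, hS j hj, hk, pos_succ, hb, show pos s k + 2 - 1 = pos s k + 1 by omega,
      mind_chain_pos_add hs one_pos (by omega), orbit_succ, length_vec_next, if_pos hd]
  · intro j hj
    obtain ⟨m, hm, hd, hnd⟩ := hκs j hj
    rw [hS j hj.le, hS (j + 1) hj, hm, orbit_succ, length_vec_next, if_pos hd,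
      length_vec_of_not_drops hnd]
    omega
  · intro j hj
    obtain ⟨m, hm, hd, hnd⟩ := hκs j hj
    rw [hS j hj.le, hS (j + 1) hj, hm, orbit_succ, sum_vec_next, if_pos hd,
      sum_vec_of_not_drops hnd]
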